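/- **Notation.** Let $\alpha\ge 0$ be real. For $n,m\ge1$ put $$\sigma_\alpha(n)=\sum_{d\mid n}d^\alpha,\qquad \sigma_{\alpha,m}(n)=\sum_{d\mid n,\ d\le\lfloor n/m\rfloor}d^\alpha$$ (also for negative exponents; $\sigma_{\alpha,1}=\sigma_\alpha$). Let ${s\brack m}$ and ${m\brace k}$ be the (unsigned) Stirling numbers of the first and second kind, let $D=\frac{d}{dq}$, and let $[q^x]$ denote the coefficient of $q^x$. Binomial coefficients $\binom{a}{b}$ with $b<0$ are $0$, and terms with a vanishing binomial coefficient or Stirling number are omitted. Define $$C_{4,s}(r,p,m)=\sum_{k=0}^m\binom sr{s-r\brack m}{m\brace k}\binom{s-r-k}{p}(-1)^{s-r-k+p}\,k!\,r!,$$ $$C_{8,s}(r,p,n,w)=\sum_{m=0}^{s-r}\sum_{k=0}^m\sum_{m_1=0}^{r+1-n}\sum_{m_2=0}^n\binom sr{s-r\brack m}{m\brace k}\binom{s-r-k}{p}{r+1-n\brack m_1}{n\brack m_2}\binom{m_2}{w-m-m_1}(-1)^{s-k+p+n+m_1+m_2}\,k!\,(n-2-r)^{m+m_1+m_2-w},$$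 $$\mathrm{Sum}_{4,s}(q,i)=\sum_{0\le r,p,m\le s}\frac{q^{(p+1)i+r}}{(1-q^i)^{s-r+1}}\left(\frac{i^{m+1}}{(1-q)^{r+1}}-\frac{(r+1)i^m}{(1-q)^{r+2}}\right)C_{4,s}(r,p,m),$$ $$\mathrm{Sum}_{8,s}(q,i)=\sum_{0\le r,p\le s}\sum_{n=0}^{r+1}\sum_{w=0}^s\frac{q^{(p+2)i+n-1}}{(1-q^i)^{s-r+1}}\left(\binom rn\frac1{(1-q)^{r+1}}-\binom{r+1}n\frac1{(1-q)^{r+2}}\right)i^w\,C_{8,s}(r,p,n,w),$$ and, for integers $s\ge1$, $x\ge0$, $$S_{01,s,x}^{(\alpha)}=[q^x]\,q^sD^{(s)}\Big[\sum_{i\ge1}\frac{i^{\alpha-1}q^i}{1-q}\Big],\quad S_{4,s,x}^{(\alpha)}=[q^x]\sum_{i\ge1}\mathrm{Sum}_{4,s}(q,i)\,i^{\alpha-1},\quad S_{8,s,x}^{(\alpha)}=[q^x]\sum_{i\ge1}\mathrm{Sum}_{8,s}(q,i)\,i^{\alpha-1},$$ and $S_{48,s,x}^{(\alpha)}=S_{4,s,x}^{(\alpha)}+S_{8,s,x}^{(\alpha)}$.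 **Statement.** For every real $\alpha\ge0$ and all integers $s\ge2$, $x\ge1$, $$\binom xs\sigma_\alpha(x)=\frac1{s!}\left(S_{01,s,x}^{(\alpha)}+S_{48,s,x}^{(\alpha)}-S_{48,s,x-1}^{(\alpha)}-s\cdot S_{48,s-1,x-1}^{(\alpha)}\right).$$ This is an exact finite formula in terms of ordinary and bounded-divisor divisor sums, since for all integers $s\ge1$ and $x\ge0$ $$S_{01,s,x}^{(\alpha)}=\sum_{r=0}^s\sum_{k=1}^x\binom sr\binom{x-k}{s-r}(s-r)!\,k^{\alpha-1}\,k(k-1)\cdots(k-r+1),$$ $$S_{4,s,x}^{(\alpha)}=\sum_{0\le p,m,u\le s}\sum_{k=1}^x\big(C_{42,s}(x,k;p,m,u)-C_{43,s}(x,k;p,m+1,u)\big)\sigma_{m+\alpha-u,p+1}(k)-\sum_{0\le p,u\le s}\sum_{k=1}^xC_{43,s}(x,k;p,0,u)\,\sigma_{\alpha-1-u,p+1}(k),$$ $$S_{8,s,x}^{(\alpha)}=\sum_{0\le p,u,w\le s}\sum_{k=1}^{x+1}\big(C_{82,s}(x,k;w,p,u)-C_{83,s}(x,k;w,p,u)\big)\sigma_{w+\alpha-1-u,p+2}(k),$$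 where $$C_{42,s}(x,k;p,m,u)=\sum_{r=0}^s\sum_{j=0}^{s-r}\binom{x-k}r{s-r\brack j}\binom ju\frac{(-1)^{s-r-u}(p+1-s+r)^{j-u}k^u}{(s-r)!}C_{4,s}(r,p,m),$$ $$C_{43,s}(x,k;p,m,u)=\sum_{r=0}^s\sum_{j=0}^{s-r}\binom{x+1-k}{r+1}{s-r\brack j}\binom ju\frac{(-1)^{s-r-u}(r+1)(p+1-s+r)^{j-u}k^u}{(s-r)!}C_{4,s}(r,p,m),$$ $$C_{82,s}(x,k;w,p,u)=\sum_{r=0}^s\sum_{n=0}^{r+1}\sum_{j=0}^{s-r}\binom{x+1-n-k+r}r\binom rn{s-r\brack j}\binom ju\frac{(-1)^{s-r-u}(p+2-s+r)^{j-u}k^u}{(s-r)!}C_{8,s}(r,p,n,w),$$ $$C_{83,s}(x,k;w,p,u)=\sum_{r=0}^s\sum_{n=0}^{r+1}\sum_{j=0}^{s-r}\binom{x+2-n-k+r}{r+1}\binom{r+1}n{s-r\brack j}\binom ju\frac{(-1)^{s-r-u}(p+2-s+r)^{j-u}k^u}{(s-r)!}C_{8,s}(r,p,n,w).$$ -/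

import Mathlib

noncomputable section

namespace DivisorSums

open PowerSeries

/-- The generalized sum-of-divisors function `σ_α(n) = ∑_{d ∣ n} d ^ α` for real `α`. -/
def sigma (α : ℝ) (n : ℕ) : ℝ := ∑ d ∈ n.divisors, (d : ℝ) ^ α

/-- The bounded-divisor sum `σ_{α,m}(n) = ∑_{d ∣ n, d ≤ ⌊n/m⌋} d ^ α`. -/
def sigmaBdd (α : ℝ) (m n : ℕ) : ℝ := ∑ d ∈ n.divisors with d ≤ n / m, (d : ℝ) ^ α

/-- The coefficient `C_{4,s}(r,p,m)`. The Stirling number of the first kind vanishes unless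
`m ≤ s - r`, so that no subtraction is truncated in a nonzero term. -/
def C4 (s r p m : ℕ) : ℝ :=
  ∑ k ∈ Finset.range (m + 1),
    (s.choose r : ℝ) * (s - r).stirlingFirst m * m.stirlingSecond k * (s - r - k).choose p
      * (-1) ^ (s - r - k + p) * k.factorial * r.factorial

/-- The coefficient `C_{8,s}(r,p,n,w)`, for `r ≤ s` and `n ≤ r + 1`. The binomial coefficient
`m₂` over `w - m - m₁` is zero when `w - m - m₁` is negative; when it is nonzero,
`m + m₁ + m₂ - w` is nonnegative. -/
def C8 (s r p n w : ℕ) : ℝ :=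
  ∑ m ∈ Finset.range (s - r + 1), ∑ k ∈ Finset.range (m + 1),
    ∑ m₁ ∈ Finset.range (r + 1 - n + 1), ∑ m₂ ∈ Finset.range (n + 1),
      (s.choose r : ℝ) * (s - r).stirlingFirst m * m.stirlingSecond k * (s - r - k).choose p
        * (r + 1 - n).stirlingFirst m₁ * n.stirlingFirst m₂
        * (if m + m₁ ≤ w then (m₂.choose (w - m - m₁) : ℝ) else 0)
        * (-1) ^ (s - k + p + n + m₁ + m₂) * k.factorial
        * ((n : ℝ) - 2 - r) ^ (m + m₁ + m₂ - w)

/-- The coefficient `C_{42,s}(x,k;p,m,u)`, for `k ≤ x`. (The binomial coefficient `j` over `u`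
vanishes unless `u ≤ j ≤ s - r`.) -/
def C42 (s x k p m u : ℕ) : ℝ :=
  ∑ r ∈ Finset.range (s + 1), ∑ j ∈ Finset.range (s - r + 1),
    ((x - k).choose r : ℝ) * (s - r).stirlingFirst j * j.choose u
      * ((-1) ^ (s - r - u) * ((p : ℝ) + 1 - s + r) ^ (j - u) * (k : ℝ) ^ u
          / (s - r).factorial)
      * C4 s r p m

/-- The coefficient `C_{43,s}(x,k;p,m,u)`, for `k ≤ x + 1`. -/
def C43 (s x k p m u : ℕ) : ℝ :=
  ∑ r ∈ Finset.range (s + 1), ∑ j ∈ Finset.range (s - r + 1),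
    ((x + 1 - k).choose (r + 1) : ℝ) * (s - r).stirlingFirst j * j.choose u
      * ((-1) ^ (s - r - u) * ((r : ℝ) + 1) * ((p : ℝ) + 1 - s + r) ^ (j - u) * (k : ℝ) ^ u
          / (s - r).factorial)
      * C4 s r p m

/-- The coefficient `C_{82,s}(x,k;w,p,u)`, for `k ≤ x + 1`. The number `x + 1 - n - k + r` is
negative only when `n = r + 1`, where the second binomial coefficient vanishes. -/
def C82 (s x k w p u : ℕ) : ℝ :=
  ∑ r ∈ Finset.range (s + 1), ∑ n ∈ Finset.range (r + 2), ∑ j ∈ Finset.range (s - r + 1),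
    ((x + 1 + r - n - k).choose r : ℝ) * r.choose n * (s - r).stirlingFirst j * j.choose u
      * ((-1) ^ (s - r - u) * ((p : ℝ) + 2 - s + r) ^ (j - u) * (k : ℝ) ^ u
          / (s - r).factorial)
      * C8 s r p n w

/-- The coefficient `C_{83,s}(x,k;w,p,u)`, for `k ≤ x + 1`. -/
def C83 (s x k w p u : ℕ) : ℝ :=
  ∑ r ∈ Finset.range (s + 1), ∑ n ∈ Finset.range (r + 2), ∑ j ∈ Finset.range (s - r + 1),
    ((x + 2 + r - n - k).choose (r + 1) : ℝ) * (r + 1).choose n * (s - r).stirlingFirst j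
      * j.choose u
      * ((-1) ^ (s - r - u) * ((p : ℝ) + 2 - s + r) ^ (j - u) * (k : ℝ) ^ u
          / (s - r).factorial)
      * C8 s r p n w

/-- The operator `q ^ s D^{(s)}` on power series in `q`. -/
def qD (s : ℕ) (g : ℝ⟦X⟧) : ℝ⟦X⟧ := X ^ s * (derivative ℝ)^[s] g

/-- The component sum `Sum_{4,s}(q,i)` as a power series in `q`. -/
def Sum4 (s i : ℕ) : ℝ⟦X⟧ :=
  ∑ r ∈ Finset.range (s + 1), ∑ p ∈ Finset.range (s + 1), ∑ m ∈ Finset.range (s + 1),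
    X ^ ((p + 1) * i + r) * ((1 - X ^ i) ^ (s - r + 1))⁻¹
      * (C ((i : ℝ) ^ (m + 1)) * ((1 - X) ^ (r + 1))⁻¹
          - C (((r : ℝ) + 1) * (i : ℝ) ^ m) * ((1 - X) ^ (r + 2))⁻¹)
      * C (C4 s r p m)

/-- The component sum `Sum_{8,s}(q,i)` as a power series in `q` (for `i ≥ 1` the exponent
`(p + 2) i + n - 1` is positive). -/
def Sum8 (s i : ℕ) : ℝ⟦X⟧ :=
  ∑ r ∈ Finset.range (s + 1), ∑ p ∈ Finset.range (s + 1), ∑ n ∈ Finset.range (r + 2),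
    ∑ w ∈ Finset.range (s + 1),
      X ^ ((p + 2) * i + n - 1) * ((1 - X ^ i) ^ (s - r + 1))⁻¹
        * (C (r.choose n : ℝ) * ((1 - X) ^ (r + 1))⁻¹
            - C ((r + 1).choose n : ℝ) * ((1 - X) ^ (r + 2))⁻¹)
        * C ((i : ℝ) ^ w) * C (C8 s r p n w)

open scoped PowerSeries.WithPiTopology in
/-- `S_{01,s,x}^{(α)} = [q^x] q^s D^{(s)} [∑_{i ≥ 1} i^{α-1} q^i / (1 - q)]`. Infinite sums of power
series converge coefficientwise. -/
def S01 (α : ℝ) (s x : ℕ) : ℝ :=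
  coeff x (qD s (∑' i : ℕ+, C ((i : ℝ) ^ (α - 1)) * X ^ (i : ℕ) * (1 - X : ℝ⟦X⟧)⁻¹))

open scoped PowerSeries.WithPiTopology in
/-- `S_{4,s,x}^{(α)} = [q^x] ∑_{i ≥ 1} Sum_{4,s}(q,i) i^{α-1}`. -/
def S4 (α : ℝ) (s x : ℕ) : ℝ :=
  coeff x (∑' i : ℕ+, Sum4 s i * C ((i : ℝ) ^ (α - 1)))

open scoped PowerSeries.WithPiTopology in
/-- `S_{8,s,x}^{(α)} = [q^x] ∑_{i ≥ 1} Sum_{8,s}(q,i) i^{α-1}`. -/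
def S8 (α : ℝ) (s x : ℕ) : ℝ :=
  coeff x (∑' i : ℕ+, Sum8 s i * C ((i : ℝ) ^ (α - 1)))

/-- `S_{48,s,x}^{(α)} = S_{4,s,x}^{(α)} + S_{8,s,x}^{(α)}`. -/
def S48 (α : ℝ) (s x : ℕ) : ℝ := S4 α s x + S8 α s x

section Convergence

open scoped PowerSeries.WithPiTopology

/-- A family of power series whose `i`-th member is divisible by `q ^ i` is summable. -/
theorem summable_of_X_pow_dvd (g : ℕ+ → ℝ⟦X⟧) (h : ∀ i : ℕ+, (X : ℝ⟦X⟧) ^ (i : ℕ) ∣ g i) :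
    Summable g := by
  rw [PowerSeries.WithPiTopology.summable_iff_summable_coeff]
  intro n
  apply summable_of_hasFiniteSupport
  refine (Set.finite_Iic (⟨n + 1, n.succ_pos⟩ : ℕ+)).subset ?_
  intro i hi
  by_contra hlt
  have hn : n < (i : ℕ) := by
    have h2 : (⟨n + 1, n.succ_pos⟩ : ℕ+) < i := not_le.mp hlt
    have h3 : n + 1 < (i : ℕ) := PNat.coe_lt_coe _ _ |>.mpr h2
    omega
  exact hi ((X_pow_dvd_iff.mp (h i)) n hn)

/-- The series in the definition of `S01` converges. -/
theorem summable_S01 (α : ℝ) :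
    Summable fun i : ℕ+ => C ((i : ℝ) ^ (α - 1)) * X ^ (i : ℕ) * (1 - X : ℝ⟦X⟧)⁻¹ :=
  summable_of_X_pow_dvd _ fun _ => (Dvd.intro_left _ rfl).mul_right _

/-- The series in the definition of `S4` converges. -/
theorem summable_S4 (α : ℝ) (s : ℕ) :
    Summable fun i : ℕ+ => Sum4 s i * C ((i : ℝ) ^ (α - 1)) := by
  refine summable_of_X_pow_dvd _ fun i => Dvd.dvd.mul_right ?_ _
  refine Finset.dvd_sum fun r _ => Finset.dvd_sum fun p _ => Finset.dvd_sum fun m _ => ?_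
  refine Dvd.dvd.mul_right (Dvd.dvd.mul_right (Dvd.dvd.mul_right (pow_dvd_pow _ ?_) _) _) _
  nlinarith [Nat.zero_le (p * (i : ℕ)), Nat.zero_le r]

/-- The series in the definition of `S8` converges. -/
theorem summable_S8 (α : ℝ) (s : ℕ) :
    Summable fun i : ℕ+ => Sum8 s i * C ((i : ℝ) ^ (α - 1)) := by
  refine summable_of_X_pow_dvd _ fun i => Dvd.dvd.mul_right ?_ _
  refine Finset.dvd_sum fun r _ => Finset.dvd_sum fun p _ => Finset.dvd_sum fun n _ =>
    Finset.dvd_sum fun w _ => ?_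
  refine Dvd.dvd.mul_right (Dvd.dvd.mul_right (Dvd.dvd.mul_right (Dvd.dvd.mul_right
    (pow_dvd_pow _ ?_) _) _) _) _
  have h1 : 1 ≤ (i : ℕ) := i.pos
  have h2 : 2 * (i : ℕ) ≤ (p + 2) * (i : ℕ) := Nat.mul_le_mul_right _ (by omega)
  omega

end Convergence

end DivisorSums

end

noncomputable section

namespace DivisorSums

open PowerSeries

/-! For each `i ≥ 1` one has `i q^i/(1-q^i) = q^i/(1-q) + (1-q) · q^i/(1-q^i) · (i/(1-q) -
(1-q^i)/(1-q)^2)`. The operator `q^s D^{(s)}` multiplies the coefficient of `q^x` by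
`x(x-1)⋯(x-s+1)`, so applied to the left side, weighted by `i^{α-1}` and summed over `i`, it
produces `s! * binom(x,s) * σ_α(x)`. On the right, the last factor is split as `(i/(1-q) -
1/(1-q)^2) + q^i/(1-q)^2`. The Leibniz rule turns the two pieces into `Sum4` and `Sum8`
(`Sum4_eq_qD`, `Sum8_eq_qD`), and the outer factor `1 - q` accounts for the terms with `x - 1` and
`s - 1` (`qD_one_sub_X_mul`). These combine in `qD_lambert_eq`.

The delicate point is `Sum8`: the derivative is a polynomial of degree `s + 1` in `i`, but `Sum8`
stops at `i^s`. The top coefficient alternates in sign with `n`, and its total contribution vanishes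
(`sum_C8_succ_self_eq_zero`).

For the closed forms, the coefficient of `q^k` in `q^{Pi}/(1-q^i)^{t+1}` is a polynomial in `k/i`
supported on `i ∣ k`, `i ≤ k/P`; its monomials give the bounded divisor sums (`sum_rpow_mul_coeff`).
-/

/-! ### Falling factorials and Stirling numbers. -/

/-- The falling factorial `y (y - 1) ⋯ (y - n + 1)`. -/
def falling (y : ℝ) (n : ℕ) : ℝ := ∏ j ∈ Finset.range n, (y - j)

@[simp] theorem falling_zero (y : ℝ) : falling y 0 = 1 := by simp [falling]

theorem falling_succ (y : ℝ) (n : ℕ) : falling y (n + 1) = falling y n * (y - n) := by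
  simp [falling, Finset.prod_range_succ]

theorem falling_succ_left (y : ℝ) (n : ℕ) : falling y (n + 1) = y * falling (y - 1) n := by
  simp only [falling, Finset.prod_range_succ']
  rw [mul_comm]
  congr 1
  · simp
  · exact Finset.prod_congr rfl fun j _ => by push_cast; ring

theorem falling_add (y : ℝ) (a b : ℕ) : falling y (a + b) = falling y a * falling (y - a) b := by
  induction b with
  | zero => simp
  | succ b ih => rw [← add_assoc, falling_succ, ih, falling_succ]; push_cast; ring

theorem falling_natCast (x n : ℕ) : falling x n = x.descFactorial n := by
  induction n with
  | zero => simp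
  | succ n ih =>
    rw [falling_succ, ih, Nat.descFactorial_succ]
    rcases le_or_gt n x with h | h
    · push_cast [Nat.cast_sub h]; ring
    · simp [Nat.descFactorial_of_lt h]

/-- Vandermonde's identity. Real arguments matter: it serves not only the Leibniz rule but also a
shift by `-2`, from the exponent of `(1-q)^{-2}`. -/
theorem falling_add_left (a b : ℝ) (n : ℕ) :
    falling (a + b) n
      = ∑ k ∈ Finset.range (n + 1), (n.choose k : ℝ) * falling a (n - k) * falling b k := by
  have key (y : ℝ) (n : ℕ) : (descPochhammer ℤ n).smeval y = falling y n := by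
    induction n with
    | zero => simp
    | succ n ih =>
      rw [descPochhammer_succ_right, Polynomial.smeval_mul, ih, falling_succ]
      simp [Polynomial.smeval_sub, Polynomial.smeval_natCast]
  rw [← key, Ring.descPochhammer_smeval_add _ (Commute.all _ _),
    Finset.Nat.sum_antidiagonal_eq_sum_range_succ_mk,
    ← Finset.sum_range_reflect]
  refine Finset.sum_congr rfl fun k hk => ?_
  have hk' : k ≤ n := Nat.lt_succ_iff.mp (Finset.mem_range.mp hk)
  have e : n + 1 - 1 - k = n - k := by omega
  simp only [key, e]
  rw [Nat.choose_symm hk', Nat.sub_sub_self hk', mul_assoc]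

theorem falling_eq_sum_stirlingFirst (y : ℝ) (n : ℕ) :
    falling y n = ∑ m ∈ Finset.range (n + 1), (-1) ^ (n + m) * (n.stirlingFirst m : ℝ) * y ^ m := by
  induction n with
  | zero => simp
  | succ n ih =>
    rw [falling_succ, Finset.sum_range_succ', ih, mul_sub, Finset.sum_mul]
    have h : (∑ m ∈ Finset.range (n + 1), (-1) ^ (n + m) * (n.stirlingFirst m : ℝ) * y ^ m) * n
        = -∑ m ∈ Finset.range (n + 1), (-1) ^ (n + 1 + (m + 1)) *
            (n * (n.stirlingFirst (m + 1) : ℝ)) * y ^ (m + 1) := by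
      rw [← Finset.sum_neg_distrib]
      have := Finset.sum_range_succ' (fun m => (-1) ^ (n + m) * (n.stirlingFirst m : ℝ) * y ^ m * n)
        (n + 1)
      rw [Finset.sum_range_succ, Nat.stirlingFirst_eq_zero_of_lt (Nat.lt_succ_self n)] at this
      have h0 : (n.stirlingFirst 0 : ℝ) * n = 0 := by cases n <;> simp
      rw [Finset.sum_mul]
      simp only [Nat.cast_zero, mul_zero, zero_mul, add_zero] at this
      rw [this, pow_zero, mul_one, mul_assoc, h0, mul_zero, add_zero]
      exact Finset.sum_congr rfl fun m _ => by ring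
    rw [h, sub_neg_eq_add, ← Finset.sum_add_distrib]
    simp only [Nat.stirlingFirst_succ_zero, Nat.cast_zero, mul_zero, zero_mul, add_zero]
    refine Finset.sum_congr rfl fun m _ => ?_
    rw [Nat.stirlingFirst_succ_succ]
    push_cast
    ring

theorem pow_eq_sum_stirlingSecond (y : ℝ) (m : ℕ) :
    y ^ m = ∑ k ∈ Finset.range (m + 1), (m.stirlingSecond k : ℝ) * falling y k := by
  induction m with
  | zero => simp
  | succ m ih =>
    rw [pow_succ, ih, Finset.sum_range_succ' _ (m + 1), Finset.sum_mul]
    have h (k : ℕ) : (m.stirlingSecond k : ℝ) * falling y k * y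
        = m.stirlingSecond k * falling y (k + 1) + k * m.stirlingSecond k * falling y k := by
      rw [falling_succ]; ring
    have h2 := Finset.sum_range_succ' (fun k => k * (m.stirlingSecond k : ℝ) * falling y k) (m + 1)
    rw [Finset.sum_range_succ, Nat.stirlingSecond_eq_zero_of_lt (Nat.lt_succ_self m)] at h2
    simp only [Nat.cast_zero, mul_zero, zero_mul, add_zero] at h2
    simp only [h, Finset.sum_add_distrib, h2]
    simp only [← Finset.sum_add_distrib, Nat.stirlingSecond_succ_zero, Nat.cast_zero, zero_mul,
      add_zero]
    refine Finset.sum_congr rfl fun k _ => ?_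
    rw [Nat.stirlingSecond_succ_succ]
    push_cast
    ring

/-- At negative integers falling factorials become the coefficients of `(1-q)^{-(k+1)}`; this is how
Stirling numbers of the second kind enter the Lambert expansion. -/
theorem falling_neg_natCast (d k : ℕ) :
    falling (-(d + 1 : ℕ)) k = (-1) ^ k * k.factorial * (d + k).choose k := by
  have h : falling (-(d + 1 : ℕ)) k = (-1) ^ k * (d + k).descFactorial k := by
    rw [Nat.add_descFactorial_eq_ascFactorial]
    induction k with
    | zero => simp
    | succ k ih => rw [falling_succ, ih, Nat.ascFactorial_succ]; push_cast; ring
  rw [h, Nat.descFactorial_eq_factorial_mul_choose]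
  push_cast
  ring

/-! ### The operator `q^s D^{(s)}`. -/

/-- The operator is diagonal on monomials, so its rules reduce to identities for falling factorials
of exponents. For `x < s` both sides vanish. -/
theorem coeff_qD (s x : ℕ) (g : ℝ⟦X⟧) : coeff x (qD s g) = x.descFactorial s * coeff x g := by
  rw [qD, coeff_X_pow_mul']
  split_ifs with h
  · rw [coeff_iterate_derivative, Nat.sub_add_cancel h, ← Nat.add_descFactorial_eq_ascFactorial,
      Nat.sub_add_cancel h]
  · rw [Nat.descFactorial_of_lt (not_le.mp h)]; simp

theorem qD_add (s : ℕ) (f g : ℝ⟦X⟧) : qD s (f + g) = qD s f + qD s g := by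
  ext x; simp [coeff_qD, mul_add]

theorem qD_sub (s : ℕ) (f g : ℝ⟦X⟧) : qD s (f - g) = qD s f - qD s g := by
  ext x; simp [coeff_qD, mul_sub]

theorem qD_C_mul (s : ℕ) (c : ℝ) (f : ℝ⟦X⟧) : qD s (C c * f) = C c * qD s f := by
  ext x; simp only [coeff_qD, coeff_C_mul]; ring

/-- The Leibniz rule for `q ^ s D^{(s)}`. -/
theorem qD_mul (s : ℕ) (f g : ℝ⟦X⟧) :
    qD s (f * g) = ∑ r ∈ Finset.range (s + 1), C (s.choose r : ℝ) * (qD (s - r) f * qD r g) := by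
  ext x
  simp only [coeff_qD, map_sum, coeff_C_mul]
  simp only [coeff_mul, coeff_qD, Finset.mul_sum]
  rw [Finset.sum_comm]
  refine Finset.sum_congr rfl fun ab hab => ?_
  rw [← Finset.HasAntidiagonal.mem_antidiagonal.mp hab, ← falling_natCast, Nat.cast_add, falling_add_left,
    Finset.sum_mul]
  refine Finset.sum_congr rfl fun r _ => ?_
  rw [falling_natCast, falling_natCast]
  ring

/-- Since `1 - X` is linear, only two Leibniz terms survive; on coefficients this is `(x+1)_s =
(x)_s + s (x)_{s-1}` for falling factorials. -/
theorem qD_one_sub_X_mul {s : ℕ} (hs : 1 ≤ s) (g : ℝ⟦X⟧) :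
    qD s ((1 - X) * g) = (1 - X) * qD s g - C (s : ℝ) * (X * qD (s - 1) g) := by
  obtain ⟨s, rfl⟩ : ∃ t, s = t + 1 := ⟨s - 1, by omega⟩
  ext x
  rw [Nat.add_sub_cancel]
  simp only [sub_mul, one_mul, map_sub, coeff_qD, coeff_C_mul]
  cases x with
  | zero => simp
  | succ x =>
    simp only [coeff_succ_X_mul, coeff_qD]
    rw [← falling_natCast, ← falling_natCast, ← falling_natCast, falling_succ_left, falling_succ]
    push_cast
    rw [add_sub_cancel_right]
    ring

/-! ### Inverse powers of `1 - q^i` and their coefficients. -/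

theorem inv_one_sub_X_pow (i a : ℕ) (hi : i ≠ 0) :
    ((1 - X ^ i : ℝ⟦X⟧) ^ a)⁻¹ = ((1 - X ^ i)⁻¹) ^ a := by
  have h : constantCoeff (1 - X ^ i : ℝ⟦X⟧) ≠ 0 := by simp [hi]
  rw [PowerSeries.inv_eq_iff_mul_eq_one (by simp [hi]), ← mul_pow, PowerSeries.inv_mul_cancel _ h,
    one_pow]

theorem inv_one_sub_pow (a : ℕ) : ((1 - X : ℝ⟦X⟧) ^ a)⁻¹ = ((1 - X)⁻¹) ^ a := by
  simpa only [pow_one] using inv_one_sub_X_pow 1 a one_ne_zero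

theorem one_sub_X_pow_mul_inv {i : ℕ} (hi : i ≠ 0) :
    (1 - X ^ i : ℝ⟦X⟧) * (1 - X ^ i)⁻¹ = 1 :=
  PowerSeries.mul_inv_cancel _ (by simp [hi])

theorem one_sub_X_mul_inv : (1 - X : ℝ⟦X⟧) * (1 - X)⁻¹ = 1 := by
  simp

theorem coeff_inv_one_sub_pow (a n : ℕ) :
    coeff n ((1 - X : ℝ⟦X⟧) ^ (a + 1))⁻¹ = (n + a).choose a := by
  have : ((1 - X : ℝ⟦X⟧) ^ (a + 1))⁻¹ = mk fun n => ((a + n).choose a : ℝ) := by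
    rw [PowerSeries.inv_eq_iff_mul_eq_one (by simp)]
    exact mk_add_choose_mul_one_sub_pow_eq_one ℝ a
  rw [this, coeff_mk, add_comm]

/-- Substitute `q^i` for `q` in `q^P/(1-q)^{t+1}`. The condition `P ≤ k / i` later becomes the bound
on the divisors. -/
theorem coeff_X_pow_mul_inv_one_sub_X_pow {i P : ℕ} (hi : i ≠ 0) (t k : ℕ) :
    coeff k (X ^ (P * i) * ((1 - X ^ i : ℝ⟦X⟧) ^ (t + 1))⁻¹)
      = if i ∣ k ∧ P ≤ k / i then ((k / i - P + t).choose t : ℝ) else 0 := by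
  have h : X ^ (P * i) * ((1 - X ^ i : ℝ⟦X⟧) ^ (t + 1))⁻¹
      = expand i hi (X ^ P * ((1 - X : ℝ⟦X⟧) ^ (t + 1))⁻¹) := by
    rw [map_mul, map_pow, expand_X, ← pow_mul, mul_comm i P]
    congr 1
    rw [PowerSeries.inv_eq_iff_mul_eq_one (by simp [hi])]
    rw [show (1 - X ^ i : ℝ⟦X⟧) ^ (t + 1) = expand i hi ((1 - X) ^ (t + 1)) by simp, ← map_mul,
      PowerSeries.inv_mul_cancel _ (by simp), map_one]
  rw [h, coeff_expand, coeff_X_pow_mul']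
  simp only [coeff_inv_one_sub_pow]
  split_ifs <;> simp_all

open scoped PowerSeries.WithPiTopology in
/-- Only the terms with `i ≤ N` matter for the coefficients of index at most `N`. -/
theorem coeff_tsum_eq_sum (f : ℕ → ℝ⟦X⟧) (hf : ∀ i, 1 ≤ i → X ^ i ∣ f i) {x N : ℕ} (hx : x ≤ N) :
    coeff x (∑' i : ℕ+, f i) = ∑ i ∈ Finset.Icc 1 N, coeff x (f i) := by
  have hs := summable_of_X_pow_dvd (fun i => f i) fun i => hf i i.pos
  have hc := (PowerSeries.WithPiTopology.hasSum_iff_hasSum_coeff ℝ).mp hs.hasSum x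
  rw [← hc.tsum_eq,
    tsum_pnat_eq_tsum_succ (f := fun i => coeff x (f i)), tsum_eq_sum (s := Finset.range N)]
  · rw [Finset.range_eq_Ico, Finset.sum_Ico_add' (fun i => coeff x (f i)) 0 N 1, zero_add]
    rfl
  · intro b hb
    rw [Finset.mem_range, not_lt] at hb
    exact X_pow_dvd_iff.mp (hf (b + 1) (by omega)) x (by omega)

/-! ### Derivatives of the Lambert term, and `Sum4`. -/

/-- The coefficient of `i ^ m q ^ {(p + 1) i} / (1 - q ^ i) ^ {t + 1}` in the expansion of
`q ^ t D^{(t)} [q ^ i / (1 - q ^ i)]`. -/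
def lambertCoeff (t p m : ℕ) : ℝ :=
  ∑ k ∈ Finset.range (m + 1), (t.stirlingFirst m : ℝ) * m.stirlingSecond k * (t - k).choose p
    * (-1) ^ (t - k + p) * k.factorial

theorem lambertCoeff_eq_zero_of_lt {t m : ℕ} (h : t < m) (p : ℕ) : lambertCoeff t p m = 0 := by
  simp [lambertCoeff, Nat.stirlingFirst_eq_zero_of_lt h]

theorem C4_eq (s r p m : ℕ) :
    C4 s r p m = s.choose r * r.factorial * lambertCoeff (s - r) p m := by
  rw [C4, lambertCoeff, Finset.mul_sum]
  exact Finset.sum_congr rfl fun k _ => by ring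

theorem one_sub_pow_eq_sum (y : ℝ⟦X⟧) {N s : ℕ} (h : N ≤ s) :
    (1 - y) ^ N = ∑ p ∈ Finset.range (s + 1), C ((N.choose p : ℝ) * (-1) ^ p) * y ^ p := by
  rw [sub_eq_neg_add, add_pow]
  refine Finset.sum_subset_zero_on_sdiff (Finset.range_subset_range.mpr (by omega)) ?_ ?_
  · intro p hp
    simp only [Finset.mem_sdiff, Finset.mem_range] at hp
    rw [Nat.choose_eq_zero_of_lt (by omega)]
    simp
  · intro p _
    simp only [map_mul, map_natCast, map_pow, map_neg, map_one, one_pow, mul_one]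
    rw [neg_pow]
    ring

/-- On `∑_d q^{id}` the operator acts by the falling factorial of `id`. First-kind Stirling numbers
expand it in powers `i^m d^m`, and second-kind ones turn `d^m` into the coefficients of
`(1-q^i)^{-(k+1)}`. -/
theorem qD_lambert_stirling (t : ℕ) {i : ℕ} (hi : i ≠ 0) :
    qD t (X ^ i * (1 - X ^ i)⁻¹)
      = ∑ m ∈ Finset.range (t + 1), ∑ k ∈ Finset.range (m + 1),
          C ((t.stirlingFirst m : ℝ) * m.stirlingSecond k * (-1) ^ (t + k) * k.factorial
            * (i : ℝ) ^ m) * (X ^ i * ((1 - X ^ i) ^ (k + 1))⁻¹) := by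
  ext n
  have h0 := coeff_X_pow_mul_inv_one_sub_X_pow (P := 1) hi 0 n
  rw [zero_add, pow_one, one_mul] at h0
  have h1 (k : ℕ) := coeff_X_pow_mul_inv_one_sub_X_pow (P := 1) hi k n
  rw [one_mul] at h1
  simp only [coeff_qD, map_sum, coeff_C_mul, h0, h1]
  split_ifs with h
  · obtain ⟨⟨d, rfl⟩, hd⟩ := h
    rw [Nat.mul_div_cancel_left _ (Nat.pos_of_ne_zero hi)] at *
    obtain ⟨d, rfl⟩ : ∃ e, d = e + 1 := ⟨d - 1, by omega⟩
    rw [← falling_natCast, falling_eq_sum_stirlingFirst, Nat.choose_zero_right, Nat.cast_one, mul_one]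
    refine Finset.sum_congr rfl fun m _ => ?_
    -- The expansion is taken at `-(d+1)` instead of `d+1`, so that the falling factorials become
    -- `binom(d+k,k)`.
    have hm : ((d + 1 : ℕ) : ℝ) ^ m = (-1) ^ m * ∑ k ∈ Finset.range (m + 1),
        (m.stirlingSecond k : ℝ) * ((-1) ^ k * k.factorial * (d + k).choose k) := by
      simp only [← falling_neg_natCast]
      rw [← pow_eq_sum_stirlingSecond, ← mul_pow]
      simp
    rw [Nat.cast_mul, mul_pow, hm]
    simp only [Finset.mul_sum]
    refine Finset.sum_congr rfl fun k _ => ?_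
    rw [Nat.add_sub_cancel]
    have : ((-1 : ℝ) ^ m) * (-1) ^ m = 1 := by rw [← mul_pow]; simp
    rw [pow_add, pow_add]
    linear_combination ((-1 : ℝ) ^ t * (t.stirlingFirst m) * i ^ m * m.stirlingSecond k * (-1) ^ k
      * k.factorial * (d + k).choose k) * this
  · simp

/-- Everything is put over the common denominator `(1-q^i)^{t+1}` by expanding `(1-q^i)^{t-k}`. The
ranges run to `s` rather than `t` to match `Sum4` and `Sum8`; the extra terms vanish. -/
theorem qD_lambert {t s : ℕ} (hts : t ≤ s) {i : ℕ} (hi : i ≠ 0) :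
    qD t (X ^ i * (1 - X ^ i)⁻¹)
      = ∑ p ∈ Finset.range (s + 1), ∑ m ∈ Finset.range (s + 1),
          C (lambertCoeff t p m * (i : ℝ) ^ m)
            * (X ^ ((p + 1) * i) * ((1 - X ^ i) ^ (t + 1))⁻¹) := by
  rw [qD_lambert_stirling t hi, Finset.sum_comm]
  have hsub : ∀ p, ∑ m ∈ Finset.range (s + 1), C (lambertCoeff t p m * (i : ℝ) ^ m)
            * (X ^ ((p + 1) * i) * ((1 - X ^ i) ^ (t + 1))⁻¹)
      = ∑ m ∈ Finset.range (t + 1), C (lambertCoeff t p m * (i : ℝ) ^ m)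
            * (X ^ ((p + 1) * i) * ((1 - X ^ i) ^ (t + 1))⁻¹) := fun p => by
    symm
    refine Finset.sum_subset (Finset.range_subset_range.mpr (by omega)) fun m _ hm => ?_
    rw [lambertCoeff_eq_zero_of_lt (by simpa using hm)]
    simp
  rw [Finset.sum_comm, Finset.sum_congr rfl fun p _ => hsub p, Finset.sum_comm]
  refine Finset.sum_congr rfl fun m hm => ?_
  simp only [lambertCoeff, Finset.sum_mul, map_sum]
  rw [Finset.sum_comm]
  refine Finset.sum_congr rfl fun k hk => ?_
  have hkt : k ≤ t := by simp at hm hk; omega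
  have hinv : ((1 - X ^ i : ℝ⟦X⟧) ^ (k + 1))⁻¹ = (1 - X ^ i) ^ (t - k) * ((1 - X ^ i) ^ (t + 1))⁻¹ := by
    rw [inv_one_sub_X_pow _ _ hi, inv_one_sub_X_pow _ _ hi, show t + 1 = (t - k) + (k + 1) by omega,
      pow_add _ (t - k), ← mul_assoc, ← mul_pow, one_sub_X_pow_mul_inv hi, one_pow, one_mul]
  rw [hinv, one_sub_pow_eq_sum _ (show t - k ≤ s by omega), Finset.sum_mul, Finset.mul_sum,
    Finset.mul_sum]
  refine Finset.sum_congr rfl fun p _ => ?_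
  have hsign : (-1 : ℝ) ^ (t + k) = (-1) ^ (t - k) := by
    rw [show t + k = (t - k) + 2 * k by omega, pow_add, pow_mul]; simp
  rw [hsign, show (p + 1) * i = i * p + i by ring, pow_add X, pow_mul, pow_add (-1 : ℝ)]
  simp only [map_mul]
  ring

theorem qD_inv_one_sub_pow (r a : ℕ) :
    qD r ((1 - X : ℝ⟦X⟧) ^ (a + 1))⁻¹
      = C ((a + r).descFactorial r : ℝ) * (X ^ r * ((1 - X) ^ (a + r + 1))⁻¹) := by
  ext n
  rw [coeff_qD, coeff_C_mul, coeff_X_pow_mul', coeff_inv_one_sub_pow]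
  split_ifs with h
  · obtain ⟨n, rfl⟩ := Nat.exists_eq_add_of_le h
    rw [coeff_inv_one_sub_pow, Nat.add_sub_cancel_left]
    norm_cast
    have h1 : (r + n + a).choose a * ((n + r).choose r)
      = (r + n + a).choose (a + r) * (a + r).choose r := by
      have := Nat.choose_mul (n := r + n + a) (k := a + r) (s := a) (by omega)
      rw [Nat.choose_symm_add (a := a) (b := r)] at this
      rw [this, show r + n + a - a = n + r by omega, show a + r - a = r by omega]
    rw [Nat.descFactorial_eq_factorial_mul_choose, Nat.descFactorial_eq_factorial_mul_choose,
      show n + (a + r) = r + n + a by omega, show r + n = n + r by omega] at *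
    linear_combination r.factorial * h1
  · rw [Nat.descFactorial_of_lt (not_le.mp h)]; simp

theorem qD_inv_one_sub (r : ℕ) :
    qD r (1 - X : ℝ⟦X⟧)⁻¹ = C (r.factorial : ℝ) * (X ^ r * ((1 - X) ^ (r + 1))⁻¹) := by
  have := qD_inv_one_sub_pow r 0
  simpa only [zero_add, pow_one, Nat.descFactorial_self] using this

theorem qD_inv_one_sub_sq (r : ℕ) :
    qD r ((1 - X : ℝ⟦X⟧) ^ 2)⁻¹
      = C (((r : ℝ) + 1) * r.factorial) * (X ^ r * ((1 - X) ^ (r + 2))⁻¹) := by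
  have := qD_inv_one_sub_pow r 1
  have h : (1 + r).descFactorial r = (r + 1).factorial := by
    have h := Nat.descFactorial_succ (r + 1) r
    rw [Nat.descFactorial_self, Nat.add_sub_cancel_left, one_mul] at h
    rw [add_comm, h]
  rw [show 1 + r + 1 = r + 2 by ring, h, Nat.factorial_succ] at this
  push_cast at this
  exact this

theorem Sum4_eq_qD (s : ℕ) {i : ℕ} (hi : i ≠ 0) :
    Sum4 s i = qD s (X ^ i * (1 - X ^ i)⁻¹ * (C (i : ℝ) * (1 - X)⁻¹ - ((1 - X) ^ 2)⁻¹)) := by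
  rw [qD_mul, Sum4]
  refine Finset.sum_congr rfl fun r _ => ?_
  rw [qD_lambert (Nat.sub_le s r) hi, qD_sub, qD_C_mul, qD_inv_one_sub, qD_inv_one_sub_sq,
    Finset.sum_mul, Finset.mul_sum]
  refine Finset.sum_congr rfl fun p _ => ?_
  rw [Finset.sum_mul, Finset.mul_sum]
  refine Finset.sum_congr rfl fun m _ => ?_
  rw [C4_eq, pow_add X, pow_succ (i : ℝ)]
  simp only [map_mul]
  ring

/-! ### Derivatives of `q^i/(1-q)^2`, and `Sum8`. -/

/-- Over the denominator `(1-q)^{r+2}`, Pascal's rule turns the `n`-th numerator into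
`-(binom(r,n-1) + q * binom(r,n))`, so neighbouring coefficients `a l` and `a (l + 1)` meet at
`q^{l+1}`. -/
theorem sum_shifted_binomials (r : ℕ) (a : ℕ → ℝ) :
    ∑ n ∈ Finset.range (r + 2), C (a n) * (X ^ n * (C (r.choose n : ℝ) * ((1 - X) ^ (r + 1))⁻¹
        - C ((r + 1).choose n : ℝ) * ((1 - X) ^ (r + 2))⁻¹))
      = -(((1 - X) ^ (r + 2))⁻¹ * ∑ l ∈ Finset.range (r + 1),
          C (r.choose l * (a (l + 1) + a l)) * X ^ (l + 1)) := by
  have hg : ((1 - X : ℝ⟦X⟧) ^ (r + 1))⁻¹ = (1 - X) * ((1 - X) ^ (r + 2))⁻¹ := by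
    rw [inv_one_sub_pow, inv_one_sub_pow, pow_succ' _ (r + 1), ← mul_assoc, one_sub_X_mul_inv,
      one_mul]
  rw [hg]
  generalize ((1 - X : ℝ⟦X⟧) ^ (r + 2))⁻¹ = g
  have h1 := Finset.sum_range_succ' (fun n => C (a n * (r.choose n : ℝ)) * X ^ n) (r + 1)
  have h2 := Finset.sum_range_succ' (fun n => C (a n * ((r + 1).choose n : ℝ)) * X ^ n) (r + 1)
  have h3 := Finset.sum_range_succ (fun n => C (a n * (r.choose n : ℝ)) * X ^ n) (r + 1)
  rw [Nat.choose_succ_self] at h3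
  simp only [Nat.choose_succ_succ', Nat.cast_add, mul_add, add_mul, map_add,
    Finset.sum_add_distrib] at h2
  have hL : ∑ n ∈ Finset.range (r + 2), C (a n) * (X ^ n * (C (r.choose n : ℝ) * ((1 - X) * g)
        - C ((r + 1).choose n : ℝ) * g))
      = g * ((1 - X) * ∑ n ∈ Finset.range (r + 1 + 1), C (a n * (r.choose n : ℝ)) * X ^ n
        - ∑ n ∈ Finset.range (r + 1 + 1), C (a n * ((r + 1).choose n : ℝ)) * X ^ n) := by
    simp only [Finset.mul_sum, ← Finset.sum_sub_distrib]
    refine Finset.sum_congr rfl fun n _ => ?_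
    simp only [map_mul]
    ring
  have hR : ∑ l ∈ Finset.range (r + 1), C (r.choose l * (a (l + 1) + a l)) * X ^ (l + 1)
      = (∑ l ∈ Finset.range (r + 1), C (a (l + 1) * (r.choose l : ℝ)) * X ^ (l + 1))
        + X * ∑ l ∈ Finset.range (r + 1), C (a l * (r.choose l : ℝ)) * X ^ l := by
    rw [Finset.mul_sum, ← Finset.sum_add_distrib]
    refine Finset.sum_congr rfl fun n _ => ?_
    simp only [map_mul, map_add]
    ring
  simp only [Nat.cast_zero, mul_zero, map_zero, zero_mul, add_zero] at h3
  simp only [Nat.choose_zero_right] at h1 h2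
  rw [hL, hR, sub_mul, one_mul, h2]
  nth_rw 2 [h3]
  rw [h1]
  ring

theorem sum_choose_mul_choose_X_pow {r k : ℕ} (hk : k ≤ r) :
    ∑ l ∈ Finset.range (r + 1),
        C ((r.choose l : ℝ) * (l.choose k : ℝ) * (-1) ^ (l + k)) * (X : ℝ⟦X⟧) ^ l
      = C (r.choose k : ℝ) * X ^ k * (1 - X) ^ (r - k) := by
  obtain ⟨d, rfl⟩ := Nat.exists_eq_add_of_le hk
  rw [Nat.add_sub_cancel_left, one_sub_pow_eq_sum X le_rfl, add_assoc, Finset.sum_range_add,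
    Finset.sum_eq_zero, zero_add, Finset.mul_sum]
  · refine Finset.sum_congr rfl fun p _ => ?_
    have h := Nat.choose_mul (n := k + d) (k := k + p) (s := k) (by omega)
    rw [Nat.add_sub_cancel_left, Nat.add_sub_cancel_left] at h
    have h' : ((k + d).choose (k + p) : ℝ) * (k + p).choose k = (k + d).choose k * d.choose p := by
      exact_mod_cast h
    rw [h', show k + p + k = p + 2 * k by ring, pow_add (-1 : ℝ), pow_mul, pow_add X]
    simp only [map_mul, even_two, Even.neg_pow, one_pow, mul_one]
    ring
  · intro l hl
    rw [Nat.choose_eq_zero_of_lt (Finset.mem_range.mp hl)]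
    simp

theorem qD_X_pow (t i : ℕ) : qD t (X ^ i : ℝ⟦X⟧) = C (falling i t) * X ^ i := by
  ext n
  rw [coeff_qD, coeff_C_mul, coeff_X_pow, falling_natCast]
  split_ifs with h
  · rw [h]
  · simp

theorem falling_neg_two (k : ℕ) : falling (-2) k = (-1) ^ k * ((k + 1) * k.factorial) := by
  have := falling_neg_natCast 1 k
  rw [add_comm 1 k, Nat.choose_succ_self_right] at this
  push_cast at this
  rw [this]
  ring

/-- Leibniz gives terms `q^k (1-q)^{r-k}` with coefficients `(i)_{r-k} (k+1) k!`. Collecting `q^l`,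
the factor `(i)_{r-l}` splits off, and since `(k+1) k! = (-1)^k (-2)_k` the rest sums by
Vandermonde. -/
theorem qD_X_pow_mul_inv_one_sub_sq (r i : ℕ) :
    qD r (X ^ i * ((1 - X : ℝ⟦X⟧) ^ 2)⁻¹)
      = X ^ i * ((1 - X) ^ (r + 2))⁻¹ * ∑ l ∈ Finset.range (r + 1),
          C ((r.choose l : ℝ) * ((-1) ^ l * (falling i (r - l)
            * falling ((i : ℝ) - (r - l : ℕ) - 2) l))) * X ^ l := by
  have hexp : ∀ l ∈ Finset.range (r + 1),
      C ((r.choose l : ℝ) * ((-1) ^ l * (falling i (r - l)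
            * falling ((i : ℝ) - (r - l : ℕ) - 2) l))) * (X : ℝ⟦X⟧) ^ l
      = ∑ k ∈ Finset.range (r + 1), C (falling i (r - k) * ((k + 1) * k.factorial))
          * (C ((r.choose l : ℝ) * (l.choose k : ℝ) * (-1) ^ (l + k)) * X ^ l) := by
    intro l hl
    have hl' : l ≤ r := by simpa [Nat.lt_succ_iff] using hl
    rw [sub_eq_add_neg _ (2 : ℝ), falling_add_left, Finset.mul_sum, Finset.mul_sum, Finset.mul_sum,
      map_sum, Finset.sum_mul]
    symm
    rw [← Finset.sum_subset (Finset.range_subset_range.mpr (show l + 1 ≤ r + 1 by omega))]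
    · refine Finset.sum_congr rfl fun k hk => ?_
      have hk' : k ≤ l := by simpa [Nat.lt_succ_iff] using hk
      rw [show r - k = (r - l) + (l - k) by omega, falling_add, falling_neg_two, ← mul_assoc,
        ← map_mul]
      congr 2
      ring
    · intro k _ hk
      rw [Nat.choose_eq_zero_of_lt (n := l) (by simpa using hk)]
      simp
  rw [Finset.sum_congr rfl hexp, Finset.sum_comm, qD_mul, Finset.mul_sum]
  refine Finset.sum_congr rfl fun k hk => ?_
  have hk' : k ≤ r := by simpa [Nat.lt_succ_iff] using hk
  have hinv : ((1 - X : ℝ⟦X⟧) ^ (k + 2))⁻¹ = (1 - X) ^ (r - k) * ((1 - X) ^ (r + 2))⁻¹ := by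
    rw [inv_one_sub_pow, inv_one_sub_pow, show r + 2 = (r - k) + (k + 2) by omega,
      pow_add _ (r - k), ← mul_assoc, ← mul_pow, one_sub_X_mul_inv, one_pow, one_mul]
  rw [← Finset.mul_sum, sum_choose_mul_choose_X_pow hk', qD_X_pow, qD_inv_one_sub_sq, hinv]
  simp only [map_mul]
  ring

/-- The coefficient of the `n`-th summand in the expansion of
`q ^ r D^{(r)} [q ^ i / (1 - q) ^ 2]`. -/
def shiftCoeff (r n : ℕ) (i : ℝ) : ℝ :=
  (-1) ^ (n + 1) * falling i (r + 1 - n) * falling (i + (n - 2 - r)) n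

/-- Up to sign, both terms contain the product on the right; the leftover factors `i-(r-l)-1` and
`i-(r-l)` carry opposite signs and differ by one. `sum_shifted_binomials` needs exactly this sum. -/
theorem shiftCoeff_succ_add {r l : ℕ} (h : l ≤ r) (i : ℝ) :
    shiftCoeff r (l + 1) i + shiftCoeff r l i
      = -((-1) ^ l * (falling i (r - l) * falling (i - (r - l : ℕ) - 2) l)) := by
  rw [shiftCoeff, shiftCoeff, show r + 1 - (l + 1) = r - l by omega,
    show r + 1 - l = r - l + 1 by omega, falling_succ_left _ l, falling_succ, Nat.cast_sub h,
    show i + ((l + 1 : ℕ) - 2 - r : ℝ) - 1 = i - (r - l) - 2 by push_cast; ring,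
    show i + ((l : ℝ) - 2 - r : ℝ) = i - (r - l) - 2 by ring]
  push_cast
  ring

theorem qD_X_pow_mul_inv_one_sub_sq_eq_sum_shiftCoeff (r : ℕ) {i : ℕ} (hi : i ≠ 0) :
    qD r (X ^ i * ((1 - X : ℝ⟦X⟧) ^ 2)⁻¹)
      = ∑ n ∈ Finset.range (r + 2), C (shiftCoeff r n i) * (X ^ (i + n - 1) *
          (C (r.choose n : ℝ) * ((1 - X) ^ (r + 1))⁻¹
            - C ((r + 1).choose n : ℝ) * ((1 - X) ^ (r + 2))⁻¹)) := by
  -- Writing `i` as a successor makes the truncated exponent `i + n - 1` honest also at `n = 0`.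
  obtain ⟨i, rfl⟩ := Nat.exists_eq_succ_of_ne_zero hi
  have h : ∀ n, C (shiftCoeff r n (i.succ : ℕ)) * (X ^ (i.succ + n - 1) *
          (C (r.choose n : ℝ) * ((1 - X) ^ (r + 1))⁻¹
            - C ((r + 1).choose n : ℝ) * ((1 - X) ^ (r + 2))⁻¹))
      = X ^ i * (C (shiftCoeff r n (i.succ : ℕ)) * (X ^ n *
          (C (r.choose n : ℝ) * ((1 - X) ^ (r + 1))⁻¹
            - C ((r + 1).choose n : ℝ) * ((1 - X) ^ (r + 2))⁻¹))) := fun n => by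
    rw [show i.succ + n - 1 = i + n by omega, pow_add]
    ring
  simp only [h]
  rw [← Finset.mul_sum, sum_shifted_binomials, qD_X_pow_mul_inv_one_sub_sq, ← mul_neg,
    ← Finset.sum_neg_distrib, Finset.mul_sum, Finset.mul_sum, Finset.mul_sum]
  refine Finset.sum_congr rfl fun l hl => ?_
  rw [shiftCoeff_succ_add (by simpa [Nat.lt_succ_iff] using hl)]
  simp only [map_mul, map_neg, Nat.succ_eq_add_one, pow_succ X]
  ring

theorem shiftCoeff_eq_sum {r n : ℕ} (hn : n ≤ r + 1) (i : ℝ) :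
    shiftCoeff r n i = ∑ m₁ ∈ Finset.range (r + 1 - n + 1), ∑ m₂ ∈ Finset.range (n + 1),
      (r + 1 - n).stirlingFirst m₁ * n.stirlingFirst m₂ * (-1) ^ (r + n + m₁ + m₂)
        * (i ^ m₁ * (i + (n - 2 - r)) ^ m₂) := by
  rw [shiftCoeff, falling_eq_sum_stirlingFirst i, falling_eq_sum_stirlingFirst _ n, mul_assoc,
    Finset.sum_mul_sum, Finset.mul_sum]
  refine Finset.sum_congr rfl fun m₁ _ => ?_
  rw [Finset.mul_sum]
  refine Finset.sum_congr rfl fun m₂ _ => ?_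
  have hs : (-1 : ℝ) ^ (r + n + m₁ + m₂)
      = (-1) ^ (n + 1) * (-1) ^ (r + 1 - n + m₁) * (-1) ^ (n + m₂) := by
    rw [← pow_add, ← pow_add, show n + 1 + (r + 1 - n + m₁) + (n + m₂) = r + n + m₁ + m₂ + 2 by omega,
      pow_add _ _ 2]
    simp
  rw [hs]
  ring

theorem C8_eq {s r : ℕ} (hr : r ≤ s) (p n w : ℕ) :
    C8 s r p n w = ∑ m ∈ Finset.range (s - r + 1), ∑ m₁ ∈ Finset.range (r + 1 - n + 1),
      ∑ m₂ ∈ Finset.range (n + 1),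
        s.choose r * lambertCoeff (s - r) p m
          * ((r + 1 - n).stirlingFirst m₁ * n.stirlingFirst m₂ * (-1) ^ (r + n + m₁ + m₂))
          * ((if m + m₁ ≤ w then (m₂.choose (w - m - m₁) : ℝ) else 0)
            * ((n : ℝ) - 2 - r) ^ (m + m₁ + m₂ - w)) := by
  rw [C8]
  refine Finset.sum_congr rfl fun m hm => ?_
  rw [Finset.sum_comm]
  refine Finset.sum_congr rfl fun m₁ _ => ?_
  rw [Finset.sum_comm]
  refine Finset.sum_congr rfl fun m₂ _ => ?_
  rw [lambertCoeff, Finset.mul_sum, Finset.sum_mul, Finset.sum_mul]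
  refine Finset.sum_congr rfl fun k hk => ?_
  have hs : (-1 : ℝ) ^ (s - k + p + n + m₁ + m₂)
      = (-1) ^ (s - r - k + p) * (-1) ^ (r + n + m₁ + m₂) := by
    rw [← pow_add]
    congr 1
    simp only [Finset.mem_range] at hm hk
    omega
  rw [hs]
  ring

theorem sum_pow_mul_choose_sub (y c : ℝ) {a b N : ℕ} (h : a + b < N) :
    ∑ w ∈ Finset.range N, y ^ w * ((if a ≤ w then (b.choose (w - a) : ℝ) else 0)
      * c ^ (a + b - w)) = y ^ a * (y + c) ^ b := by
  obtain ⟨d, rfl⟩ := Nat.exists_eq_add_of_le (show a + (b + 1) ≤ N by omega)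
  rw [add_assoc a, Finset.sum_range_add, Finset.sum_eq_zero, zero_add, Finset.sum_range_add, add_pow,
    Finset.mul_sum]
  · rw [Finset.sum_eq_zero (s := Finset.range d), add_zero]
    · refine Finset.sum_congr rfl fun k _ => ?_
      rw [if_pos (by omega), Nat.add_sub_cancel_left, show a + b - (a + k) = b - k by omega, pow_add]
      ring
    · intro k _
      rw [if_pos (by omega), Nat.choose_eq_zero_of_lt (by omega)]
      simp
  · intro w hw
    rw [if_neg (by simpa using hw)]
    simp

/-- `C8` collects the powers of `i` in the product of the Lambert polynomial, of degree at most `s -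
r`, and `shiftCoeff`, of degree `r + 1`. Hence `w` runs to `s + 1`, one further than in `Sum8`. -/
theorem sum_pow_mul_C8 {s r n : ℕ} (hr : r ≤ s) (hn : n ≤ r + 1) (p : ℕ) (i : ℝ) :
    ∑ w ∈ Finset.range (s + 2), i ^ w * C8 s r p n w
      = s.choose r * (∑ m ∈ Finset.range (s - r + 1), lambertCoeff (s - r) p m * i ^ m)
        * shiftCoeff r n i := by
  rw [shiftCoeff_eq_sum hn, mul_assoc, Finset.sum_mul, Finset.mul_sum]
  simp only [C8_eq hr, Finset.mul_sum]
  rw [Finset.sum_comm]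
  refine Finset.sum_congr rfl fun m hm => ?_
  rw [Finset.sum_comm]
  refine Finset.sum_congr rfl fun m₁ hm₁ => ?_
  rw [Finset.sum_comm]
  refine Finset.sum_congr rfl fun m₂ hm₂ => ?_
  simp only [Finset.mem_range] at hm hm₁ hm₂
  have h := sum_pow_mul_choose_sub i ((n : ℝ) - 2 - r) (a := m + m₁) (b := m₂) (N := s + 2) (by omega)
  simp only [Nat.sub_sub]
  calc _ = s.choose r * lambertCoeff (s - r) p m
          * ((r + 1 - n).stirlingFirst m₁ * n.stirlingFirst m₂ * (-1) ^ (r + n + m₁ + m₂))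
          * ∑ w ∈ Finset.range (s + 2), i ^ w *
            ((if m + m₁ ≤ w then (m₂.choose (w - (m + m₁)) : ℝ) else 0)
              * ((n : ℝ) - 2 - r) ^ (m + m₁ + m₂ - w)) := by
        rw [Finset.mul_sum]
        exact Finset.sum_congr rfl fun w _ => by ring
    _ = _ := by rw [h, pow_add]; ring

/-- The top coefficient depends on `n` only through its sign. -/
theorem C8_succ_self {s r n : ℕ} (hr : r ≤ s) (hn : n ≤ r + 1) (p : ℕ) :
    C8 s r p n (s + 1) = -(-1) ^ n * (s.choose r * lambertCoeff (s - r) p (s - r)) := by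
  -- A nonzero binomial needs `m + m₁ + m₂ ≥ s + 1`, which forces all three indices to be maximal.
  rw [C8_eq hr, Finset.sum_eq_single (s - r), Finset.sum_eq_single (r + 1 - n),
    Finset.sum_eq_single n]
  · rw [if_pos (by omega), show s + 1 - (s - r) - (r + 1 - n) = n by omega,
      show s - r + (r + 1 - n) + n - (s + 1) = 0 by omega,
      show r + n + (r + 1 - n) + n = 2 * r + 1 + n by omega, pow_add, pow_add, pow_mul]
    simp only [Nat.stirlingFirst_self, Nat.choose_self]
    norm_num
    ring
  · intro m₂ hm₂ hne
    rw [Finset.mem_range] at hm₂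
    rw [if_pos (by omega), Nat.choose_eq_zero_of_lt (show m₂ < s + 1 - (s - r) - (r + 1 - n) by omega)]
    simp
  · simp
  · intro m₁ hm₁ hne
    refine Finset.sum_eq_zero fun m₂ hm₂ => ?_
    rw [Finset.mem_range] at hm₁ hm₂
    rw [if_pos (by omega), Nat.choose_eq_zero_of_lt (show m₂ < s + 1 - (s - r) - m₁ by omega)]
    simp
  · simp
  · intro m hm hne
    refine Finset.sum_eq_zero fun m₁ hm₁ => Finset.sum_eq_zero fun m₂ hm₂ => ?_
    rw [Finset.mem_range] at hm hm₁ hm₂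
    rw [if_pos (by omega), Nat.choose_eq_zero_of_lt (show m₂ < s + 1 - m - m₁ by omega)]
    simp
  · simp

/-- The top coefficients alternate in sign with `n`, so the neighbour sums in
`sum_shifted_binomials` are zero. -/
theorem sum_C8_succ_self_eq_zero {s r : ℕ} (hr : r ≤ s) (p : ℕ) :
    ∑ n ∈ Finset.range (r + 2), C (C8 s r p n (s + 1)) * ((X : ℝ⟦X⟧) ^ n *
      (C (r.choose n : ℝ) * ((1 - X) ^ (r + 1))⁻¹
        - C ((r + 1).choose n : ℝ) * ((1 - X) ^ (r + 2))⁻¹)) = 0 := by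
  have h : ∀ n ∈ Finset.range (r + 2), C8 s r p n (s + 1)
      = -(-1) ^ n * (s.choose r * lambertCoeff (s - r) p (s - r)) := fun n hn =>
    C8_succ_self hr (by rw [Finset.mem_range] at hn; omega) p
  rw [Finset.sum_congr rfl fun n hn => by rw [h n hn], sum_shifted_binomials r
    fun n => -(-1) ^ n * (s.choose r * lambertCoeff (s - r) p (s - r)), Finset.sum_eq_zero]
  · simp
  · intro l _
    rw [pow_succ]
    simp

theorem Sum8_eq_qD (s : ℕ) {i : ℕ} (hi : i ≠ 0) :
    Sum8 s i = qD s (X ^ i * (1 - X ^ i)⁻¹ * (X ^ i * ((1 - X) ^ 2)⁻¹)) := by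
  rw [qD_mul, Sum8]
  refine Finset.sum_congr rfl fun r hr => ?_
  have hr' : r ≤ s := by simpa [Nat.lt_succ_iff] using hr
  rw [qD_lambert (Nat.sub_le s r) hi, qD_X_pow_mul_inv_one_sub_sq_eq_sum_shiftCoeff r hi,
    Finset.sum_mul, Finset.mul_sum]
  refine Finset.sum_congr rfl fun p _ => ?_
  obtain ⟨i, rfl⟩ := Nat.exists_eq_succ_of_ne_zero hi
  set V := ((1 - X ^ i.succ : ℝ⟦X⟧) ^ (s - r + 1))⁻¹
  set B : ℕ → ℝ⟦X⟧ := fun n => C (r.choose n : ℝ) * ((1 - X) ^ (r + 1))⁻¹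
    - C ((r + 1).choose n : ℝ) * ((1 - X) ^ (r + 2))⁻¹
  have hsub : ∑ m ∈ Finset.range (s + 1), C (lambertCoeff (s - r) p m * ((i.succ : ℕ) : ℝ) ^ m)
        * (X ^ ((p + 1) * i.succ) * V)
      = C (∑ m ∈ Finset.range (s - r + 1), lambertCoeff (s - r) p m * ((i.succ : ℕ) : ℝ) ^ m)
        * (X ^ ((p + 1) * i.succ) * V) := by
    rw [map_sum, Finset.sum_mul]
    symm
    refine Finset.sum_subset (Finset.range_subset_range.mpr (by omega)) fun m _ hm => ?_
    rw [lambertCoeff_eq_zero_of_lt (by simpa using hm)]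
    simp
  have hX (n : ℕ) : (X : ℝ⟦X⟧) ^ ((p + 2) * i.succ + n - 1)
      = X ^ ((p + 1) * i.succ) * X ^ i * X ^ n := by
    rw [← pow_add, ← pow_add]
    congr 1
    rw [show (p + 2) * i.succ = (p + 1) * i.succ + i + 1 by rw [Nat.succ_eq_add_one]; ring]
    omega
  have hX' (n : ℕ) : (X : ℝ⟦X⟧) ^ (i.succ + n - 1) = X ^ i * X ^ n := by
    rw [← pow_add]
    congr 1
    omega
  -- The truncated sum over `w` is the full polynomial minus its top term; the top terms cancel only
  -- after summation over `n`.
  have hC : ∀ n ∈ Finset.range (r + 2),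
      C (∑ w ∈ Finset.range (s + 1), ((i.succ : ℕ) : ℝ) ^ w * C8 s r p n w)
      = C (s.choose r * (∑ m ∈ Finset.range (s - r + 1), lambertCoeff (s - r) p m
          * ((i.succ : ℕ) : ℝ) ^ m) * shiftCoeff r n (i.succ : ℕ))
        - C (((i.succ : ℕ) : ℝ) ^ (s + 1)) * C (C8 s r p n (s + 1)) := by
    intro n hn
    rw [Finset.mem_range] at hn
    rw [← sum_pow_mul_C8 hr' (by omega) p, Finset.sum_range_succ _ (s + 1), ← map_mul, ← map_sub]
    congr 1
    ring
  calc _ = ∑ n ∈ Finset.range (r + 2), X ^ ((p + 1) * i.succ) * X ^ i * V *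
        (C (∑ w ∈ Finset.range (s + 1), ((i.succ : ℕ) : ℝ) ^ w * C8 s r p n w) * (X ^ n * B n)) := by
        refine Finset.sum_congr rfl fun n _ => ?_
        rw [map_sum, Finset.sum_mul, Finset.mul_sum]
        refine Finset.sum_congr rfl fun w _ => ?_
        rw [hX, map_mul]
        ring
    _ = (∑ n ∈ Finset.range (r + 2), X ^ ((p + 1) * i.succ) * X ^ i * V *
          (C (s.choose r * (∑ m ∈ Finset.range (s - r + 1), lambertCoeff (s - r) p m
          * ((i.succ : ℕ) : ℝ) ^ m) * shiftCoeff r n (i.succ : ℕ)) * (X ^ n * B n)))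
        - X ^ ((p + 1) * i.succ) * X ^ i * V * C (((i.succ : ℕ) : ℝ) ^ (s + 1)) *
          ∑ n ∈ Finset.range (r + 2), C (C8 s r p n (s + 1)) * (X ^ n * B n) := by
        rw [Finset.mul_sum (Finset.range (r + 2)), ← Finset.sum_sub_distrib]
        refine Finset.sum_congr rfl fun n hn => ?_
        rw [hC n hn]
        ring
    _ = _ := by
        rw [sum_C8_succ_self_eq_zero hr', mul_zero, sub_zero, hsub, Finset.mul_sum (Finset.range (r + 2)),
          Finset.mul_sum (Finset.range (r + 2))]
        refine Finset.sum_congr rfl fun n _ => ?_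
        rw [hX', map_mul, map_mul]
        ring

/-! ### Reduction to finite sums and the exact formula. -/

theorem X_pow_dvd_Sum4 (s i : ℕ) : (X : ℝ⟦X⟧) ^ i ∣ Sum4 s i := by
  refine Finset.dvd_sum fun r _ => Finset.dvd_sum fun p _ => Finset.dvd_sum fun m _ => ?_
  refine Dvd.dvd.mul_right (Dvd.dvd.mul_right (Dvd.dvd.mul_right (pow_dvd_pow _ ?_) _) _) _
  nlinarith [Nat.zero_le (p * i), Nat.zero_le r]

theorem X_pow_dvd_Sum8 (s : ℕ) {i : ℕ} (hi : 1 ≤ i) : (X : ℝ⟦X⟧) ^ i ∣ Sum8 s i := by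
  refine Finset.dvd_sum fun r _ => Finset.dvd_sum fun p _ => Finset.dvd_sum fun n _ =>
    Finset.dvd_sum fun w _ => ?_
  refine Dvd.dvd.mul_right (Dvd.dvd.mul_right (Dvd.dvd.mul_right (Dvd.dvd.mul_right
    (pow_dvd_pow _ ?_) _) _) _) _
  have h2 : 2 * i ≤ (p + 2) * i := Nat.mul_le_mul_right _ (by omega)
  omega

theorem S01_eq_sum (α : ℝ) (s : ℕ) {x N : ℕ} (h : x ≤ N) :
    S01 α s x = ∑ i ∈ Finset.Icc 1 N,
      (i : ℝ) ^ (α - 1) * coeff x (qD s (X ^ i * (1 - X)⁻¹)) := by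
  rw [S01, coeff_qD, coeff_tsum_eq_sum
    (fun i => C ((i : ℝ) ^ (α - 1)) * X ^ i * (1 - X : ℝ⟦X⟧)⁻¹)
    (fun i _ => (Dvd.intro_left _ rfl).mul_right _) h, Finset.mul_sum]
  refine Finset.sum_congr rfl fun i _ => ?_
  rw [coeff_qD, mul_assoc, coeff_C_mul]
  ring

theorem S4_eq_sum (α : ℝ) (s : ℕ) {x N : ℕ} (h : x ≤ N) :
    S4 α s x = ∑ i ∈ Finset.Icc 1 N, (i : ℝ) ^ (α - 1) * coeff x (Sum4 s i) := by
  rw [S4, coeff_tsum_eq_sum (fun i => Sum4 s i * C ((i : ℝ) ^ (α - 1)))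
    (fun i _ => (X_pow_dvd_Sum4 s i).mul_right _) h]
  exact Finset.sum_congr rfl fun i _ => by rw [coeff_mul_C, mul_comm]

theorem S8_eq_sum (α : ℝ) (s : ℕ) {x N : ℕ} (h : x ≤ N) :
    S8 α s x = ∑ i ∈ Finset.Icc 1 N, (i : ℝ) ^ (α - 1) * coeff x (Sum8 s i) := by
  rw [S8, coeff_tsum_eq_sum (fun i => Sum8 s i * C ((i : ℝ) ^ (α - 1)))
    (fun i hi => (X_pow_dvd_Sum8 s hi).mul_right _) h]
  exact Finset.sum_congr rfl fun i _ => by rw [coeff_mul_C, mul_comm]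

/-- The generating-function identity behind the exact formula, for one term of the Lambert
series. -/
theorem qD_lambert_eq {s i : ℕ} (hs : 1 ≤ s) (hi : i ≠ 0) :
    qD s (C (i : ℝ) * (X ^ i * (1 - X ^ i)⁻¹))
      = qD s (X ^ i * (1 - X)⁻¹) + (1 - X) * (Sum4 s i + Sum8 s i)
        - C (s : ℝ) * (X * (Sum4 (s - 1) i + Sum8 (s - 1) i)) := by
  simp only [Sum4_eq_qD _ hi, Sum8_eq_qD _ hi, ← qD_add]
  -- The terms in `s` and `s - 1` recombine into one derivative, leaving an identity between the
  -- arguments of `qD`.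
  rw [add_sub_assoc, ← qD_one_sub_X_mul hs, ← qD_add]
  congr 1
  rw [inv_one_sub_pow]
  have h1 := one_sub_X_pow_mul_inv hi
  have h2 := one_sub_X_mul_inv
  generalize (1 - X ^ i : ℝ⟦X⟧)⁻¹ = v at *
  generalize (1 - X : ℝ⟦X⟧)⁻¹ = u at *
  linear_combination (X ^ i * u * (1 - X) * u) * h1 + (X ^ i * u - C (i : ℝ) * X ^ i * v) * h2

theorem coeff_lambert {i : ℕ} (hi : i ≠ 0) {x : ℕ} (hx : 1 ≤ x) :
    coeff x (X ^ i * (1 - X ^ i : ℝ⟦X⟧)⁻¹) = if i ∣ x then 1 else 0 := by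
  have h := coeff_X_pow_mul_inv_one_sub_X_pow (P := 1) hi 0 x
  rw [zero_add, pow_one, one_mul] at h
  rw [h]
  by_cases hd : i ∣ x
  · rw [if_pos ⟨hd, Nat.div_pos (Nat.le_of_dvd hx hd) (Nat.pos_of_ne_zero hi)⟩, if_pos hd]
    simp
  · rw [if_neg (fun h => hd h.1), if_neg hd]

theorem filter_dvd_Icc {k N : ℕ} (hk : 1 ≤ k) (hkN : k ≤ N) :
    {i ∈ Finset.Icc 1 N | i ∣ k} = k.divisors := by
  ext i
  simp only [Finset.mem_filter, Finset.mem_Icc, Nat.mem_divisors]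
  constructor
  · rintro ⟨_, h⟩
    exact ⟨h, by omega⟩
  · rintro ⟨h, _⟩
    exact ⟨⟨Nat.pos_of_dvd_of_pos h hk, (Nat.le_of_dvd hk h).trans hkN⟩, h⟩

theorem choose_mul_sigma_eq (α : ℝ) {s x : ℕ} (hs : 1 ≤ s) (hx : 1 ≤ x) :
    (x.choose s : ℝ) * sigma α x
      = 1 / (s.factorial : ℝ)
          * (S01 α s x + S48 α s x - S48 α s (x - 1) - s * S48 α (s - 1) (x - 1)) := by
  obtain ⟨y, rfl⟩ : ∃ y, x = y + 1 := ⟨x - 1, by omega⟩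
  -- All sums are cut at the same bound `y + 1`, even for coefficients of index `y`, so that they
  -- can be compared term by term in `i`.
  rw [Nat.add_sub_cancel, S48, S48, S48, S01_eq_sum α s le_rfl, S4_eq_sum α s le_rfl,
    S8_eq_sum α s le_rfl, S4_eq_sum α s (Nat.le_succ y), S8_eq_sum α s (Nat.le_succ y),
    S4_eq_sum α (s - 1) (Nat.le_succ y), S8_eq_sum α (s - 1) (Nat.le_succ y)]
  simp only [Nat.succ_eq_add_one, ← Finset.sum_add_distrib, ← Finset.sum_sub_distrib, Finset.mul_sum]
  have hc : ((y + 1).choose s : ℝ) = 1 / s.factorial * (y + 1).descFactorial s := by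
    rw [Nat.descFactorial_eq_factorial_mul_choose]
    have : (s.factorial : ℝ) ≠ 0 := by exact_mod_cast s.factorial_ne_zero
    push_cast
    field_simp
  rw [sigma, ← filter_dvd_Icc hx le_rfl, Finset.sum_filter, hc, Finset.mul_sum]
  refine Finset.sum_congr rfl fun i hi => ?_
  have hi0 : i ≠ 0 := by rw [Finset.mem_Icc] at hi; omega
  have h := congrArg (coeff (y + 1)) (qD_lambert_eq hs hi0)
  simp only [sub_mul, one_mul, map_add, map_sub, coeff_C_mul, coeff_succ_X_mul] at h
  rw [coeff_qD, coeff_C_mul, coeff_lambert hi0 hx] at h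
  have hp : (if i ∣ y + 1 then (i : ℝ) ^ α else 0)
      = (i : ℝ) ^ (α - 1) * (i * if i ∣ y + 1 then 1 else 0) := by
    split_ifs
    · rw [mul_one, Real.rpow_sub_one (by exact_mod_cast hi0)]
      field_simp
    · simp
  rw [hp]
  linear_combination (1 / (s.factorial : ℝ) * (i : ℝ) ^ (α - 1)) * h

/-! ### Closed forms through bounded divisor sums. -/

/-- Vandermonde's identity for the falling factorial of `x = (x - k) + k`. -/
theorem S01_eq (α : ℝ) (s x : ℕ) :
    S01 α s x = ∑ r ∈ Finset.range (s + 1), ∑ k ∈ Finset.Icc 1 x,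
      (s.choose r : ℝ) * (x - k).choose (s - r) * (s - r).factorial
        * (k : ℝ) ^ (α - 1) * k.descFactorial r := by
  rw [S01_eq_sum α s le_rfl, Finset.sum_comm]
  refine Finset.sum_congr rfl fun k hk => ?_
  rw [Finset.mem_Icc] at hk
  have h1 := coeff_inv_one_sub_pow 0 (x - k)
  rw [zero_add, pow_one] at h1
  rw [coeff_qD, coeff_X_pow_mul', if_pos hk.2, h1, ← falling_natCast,
    show (x : ℝ) = (x - k : ℕ) + k by push_cast [Nat.cast_sub hk.2]; ring, falling_add_left,
    Finset.sum_mul, Finset.mul_sum]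
  refine Finset.sum_congr rfl fun r _ => ?_
  rw [falling_natCast, falling_natCast, Nat.descFactorial_eq_factorial_mul_choose (x - k)]
  push_cast
  simp only [Nat.choose_zero_right, Nat.cast_one]
  ring

/-- The coefficient with which the `u`-th bounded divisor sum of `k` enters
`[q ^ k] ∑_i i ^ e q ^ {P i} / (1 - q ^ i) ^ {t + 1}`. -/
def divisorCoeff (t : ℕ) (c : ℝ) (k u : ℕ) : ℝ :=
  ∑ j ∈ Finset.range (t + 1), (t.stirlingFirst j : ℝ) * j.choose u
    * ((-1) ^ (t - u) * c ^ (j - u) * (k : ℝ) ^ u / t.factorial)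

/-- Times `t!`, the binomial is the falling factorial of `d - (P - t)`, hence a polynomial in `d`;
writing `d^u = (i d)^u / i^u` lowers the exponent of the divisor by `u`. -/
theorem choose_eq_sum_divisorCoeff {s t : ℕ} (hts : t ≤ s) {i d P : ℕ} (hi : i ≠ 0) (hP : P ≤ d) :
    ((d - P + t).choose t : ℝ)
      = ∑ u ∈ Finset.range (s + 1), divisorCoeff t ((P : ℝ) - t) (i * d) u * ((i : ℝ) ^ u)⁻¹ := by
  have hi' : (i : ℝ) ≠ 0 := by exact_mod_cast hi
  have hf : (t.factorial : ℝ) ≠ 0 := by exact_mod_cast t.factorial_ne_zero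
  have h : (t.factorial : ℝ) * ((d - P + t).choose t : ℝ) = falling ((d : ℝ) - (P - t)) t := by
    rw [show (d : ℝ) - (P - t) = (d - P + t : ℕ) by push_cast [Nat.cast_sub hP]; ring,
      falling_natCast, Nat.descFactorial_eq_factorial_mul_choose]
    push_cast
    ring
  refine mul_left_cancel₀ hf ?_
  simp only [divisorCoeff, Finset.mul_sum, Finset.sum_mul]
  rw [h, falling_eq_sum_stirlingFirst, Finset.sum_comm]
  refine Finset.sum_congr rfl fun j hj => ?_
  rw [Finset.mem_range] at hj
  rw [sub_eq_add_neg, add_pow, Finset.mul_sum]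
  have hsub := Finset.sum_subset (Finset.range_subset_range.mpr (show j + 1 ≤ s + 1 by omega))
    (f := fun u => (t.factorial : ℝ) * ((t.stirlingFirst j : ℝ) * j.choose u
    * ((-1) ^ (t - u) * ((P : ℝ) - t) ^ (j - u) * ((i * d : ℕ) : ℝ) ^ u / t.factorial)
      * ((i : ℝ) ^ u)⁻¹)) (fun u _ hu => by
        rw [Nat.choose_eq_zero_of_lt (n := j) (by simpa using hu)]
        simp)
  rw [← hsub]
  refine Finset.sum_congr rfl fun u hu => ?_
  rw [Finset.mem_range] at hu
  have hs : (-1 : ℝ) ^ (t - u) = (-1) ^ (t + j) * (-1) ^ (j - u) := by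
    rw [← pow_add, show t + j + (j - u) = (t - u) + 2 * j by omega, pow_add _ _ (2 * j), pow_mul _ 2]
    simp
  rw [hs, neg_pow ((P : ℝ) - t), Nat.cast_mul, mul_pow]
  field_simp

/-- Only divisors `i` of `k` contribute, and `P ≤ k / i` is equivalent to `i ≤ k / P`. -/
theorem sum_rpow_mul_coeff (e : ℝ) {s t : ℕ} (hts : t ≤ s) {k N P : ℕ} (hk : 1 ≤ k) (hkN : k ≤ N)
    (hP : 1 ≤ P) :
    ∑ i ∈ Finset.Icc 1 N,
        (i : ℝ) ^ e * coeff k (X ^ (P * i) * ((1 - X ^ i : ℝ⟦X⟧) ^ (t + 1))⁻¹)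
      = ∑ u ∈ Finset.range (s + 1), divisorCoeff t ((P : ℝ) - t) k u * sigmaBdd (e - u) P k := by
  simp only [sigmaBdd, Finset.mul_sum]
  rw [Finset.sum_comm, ← filter_dvd_Icc hk hkN, Finset.filter_filter, Finset.sum_filter]
  refine Finset.sum_congr rfl fun i hi => ?_
  rw [Finset.mem_Icc] at hi
  have hi0 : i ≠ 0 := by omega
  have hiff : (i ∣ k ∧ P ≤ k / i) ↔ (i ∣ k ∧ i ≤ k / P) := by
    rw [Nat.le_div_iff_mul_le (by omega), Nat.le_div_iff_mul_le (by omega), mul_comm]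
  rw [coeff_X_pow_mul_inv_one_sub_X_pow hi0]
  simp only [hiff]
  split_ifs with h
  · obtain ⟨⟨d, rfl⟩, hd⟩ := hiff.mpr h
    rw [Nat.mul_div_cancel_left _ (Nat.pos_of_ne_zero hi0)] at *
    rw [choose_eq_sum_divisorCoeff hts hi0 hd, Finset.mul_sum]
    refine Finset.sum_congr rfl fun u _ => ?_
    rw [Real.rpow_sub_natCast (by exact_mod_cast hi0)]
    ring
  · simp

theorem coeff_mul_eq_sum_Icc (x : ℕ) (f g : ℝ⟦X⟧) (hf : coeff 0 f = 0) :
    coeff x (f * g) = ∑ k ∈ Finset.Icc 1 x, coeff k f * coeff (x - k) g := by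
  rw [coeff_mul, Finset.Nat.sum_antidiagonal_eq_sum_range_succ_mk, Finset.sum_range_succ', hf,
    zero_mul, add_zero, Finset.range_eq_Ico,
    Finset.sum_Ico_add' (fun k => coeff k f * coeff (x - k) g) 0 x 1, zero_add]
  rfl

theorem coeff_X_pow_mul_inv_one_sub_pow (r n : ℕ) :
    coeff n ((X : ℝ⟦X⟧) ^ r * ((1 - X) ^ (r + 1))⁻¹) = (n.choose r : ℝ) := by
  rw [coeff_X_pow_mul', coeff_inv_one_sub_pow]
  split_ifs with h
  · rw [Nat.sub_add_cancel h]
  · rw [Nat.choose_eq_zero_of_lt (by omega), Nat.cast_zero]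

theorem coeff_X_pow_mul_inv_one_sub_pow_succ (r n : ℕ) :
    coeff n ((X : ℝ⟦X⟧) ^ r * ((1 - X) ^ (r + 2))⁻¹) = ((n + 1).choose (r + 1) : ℝ) := by
  rw [← coeff_succ_X_mul, ← mul_assoc, ← pow_succ', coeff_X_pow_mul_inv_one_sub_pow (r + 1)]

theorem coeff_zero_X_pow_mul {i P : ℕ} (hi : i ≠ 0) (hP : 1 ≤ P) (f : ℝ⟦X⟧) :
    coeff 0 (X ^ (P * i) * f) = 0 := by
  have : P * i ≠ 0 := Nat.mul_ne_zero (by omega) hi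
  simp [this]

/-- Cauchy product of the Lambert factor (index `k`) with a power of `1/(1-q)` (index `x - k`).
Attaching `q^r` to the latter gives the binomials of `C42` and `C43`. -/
theorem coeff_Sum4 (s x : ℕ) {i : ℕ} (hi : i ≠ 0) :
    coeff x (Sum4 s i) = ∑ p ∈ Finset.range (s + 1), ∑ m ∈ Finset.range (s + 1),
      ∑ k ∈ Finset.Icc 1 x, ∑ r ∈ Finset.range (s + 1),
        C4 s r p m * ((x - k).choose r * (i : ℝ) ^ (m + 1)
            - ((x + 1 - k).choose (r + 1) * (r + 1)) * (i : ℝ) ^ m)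
          * coeff k (X ^ ((p + 1) * i) * ((1 - X ^ i : ℝ⟦X⟧) ^ (s - r + 1))⁻¹) := by
  rw [Sum4, Finset.sum_comm, map_sum]
  refine Finset.sum_congr rfl fun p _ => ?_
  rw [Finset.sum_comm, map_sum]
  refine Finset.sum_congr rfl fun m _ => ?_
  rw [Finset.sum_comm, map_sum]
  refine Finset.sum_congr rfl fun r _ => ?_
  have h : X ^ ((p + 1) * i + r) * ((1 - X ^ i : ℝ⟦X⟧) ^ (s - r + 1))⁻¹
      * (C ((i : ℝ) ^ (m + 1)) * ((1 - X) ^ (r + 1))⁻¹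
          - C (((r : ℝ) + 1) * (i : ℝ) ^ m) * ((1 - X) ^ (r + 2))⁻¹)
      * C (C4 s r p m)
      = C (C4 s r p m) * (X ^ ((p + 1) * i) * ((1 - X ^ i : ℝ⟦X⟧) ^ (s - r + 1))⁻¹
        * (C ((i : ℝ) ^ (m + 1)) * (X ^ r * ((1 - X) ^ (r + 1))⁻¹)
          - C (((r : ℝ) + 1) * (i : ℝ) ^ m) * (X ^ r * ((1 - X) ^ (r + 2))⁻¹))) := by
    rw [pow_add X]
    ring
  rw [h, coeff_C_mul, coeff_mul_eq_sum_Icc _ _ _ (coeff_zero_X_pow_mul hi (by omega) _),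
    Finset.mul_sum]
  refine Finset.sum_congr rfl fun k hk => ?_
  rw [Finset.mem_Icc] at hk
  rw [map_sub, coeff_C_mul, coeff_C_mul, coeff_X_pow_mul_inv_one_sub_pow,
    coeff_X_pow_mul_inv_one_sub_pow_succ, show x - k + 1 = x + 1 - k by omega]
  ring

theorem C42_eq (s x k p m u : ℕ) :
    C42 s x k p m u = ∑ r ∈ Finset.range (s + 1), C4 s r p m * (x - k).choose r
      * divisorCoeff (s - r) ((p + 1 : ℕ) - (s - r : ℕ)) k u := by
  refine Finset.sum_congr rfl fun r hr => ?_
  rw [Finset.mem_range] at hr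
  rw [divisorCoeff, Finset.mul_sum]
  refine Finset.sum_congr rfl fun j _ => ?_
  rw [Nat.cast_sub (show r ≤ s by omega), show (((p + 1 : ℕ) : ℝ) - (s - r)) = p + 1 - s + r by
    push_cast; ring]
  ring

theorem C43_eq (s x k p m u : ℕ) :
    C43 s x k p m u = ∑ r ∈ Finset.range (s + 1), C4 s r p m * ((x + 1 - k).choose (r + 1) * (r + 1))
      * divisorCoeff (s - r) ((p + 1 : ℕ) - (s - r : ℕ)) k u := by
  refine Finset.sum_congr rfl fun r hr => ?_
  rw [Finset.mem_range] at hr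
  rw [divisorCoeff, Finset.mul_sum]
  refine Finset.sum_congr rfl fun j _ => ?_
  rw [Nat.cast_sub (show r ≤ s by omega), show (((p + 1 : ℕ) : ℝ) - (s - r)) = p + 1 - s + r by
    push_cast; ring]
  ring

theorem S4_eq_sum_sub_sum (α : ℝ) (s x : ℕ) :
    S4 α s x = ∑ p ∈ Finset.range (s + 1), ∑ m ∈ Finset.range (s + 1), ∑ k ∈ Finset.Icc 1 x,
      ∑ u ∈ Finset.range (s + 1), (C42 s x k p m u * sigmaBdd (m + α - u) (p + 1) k
        - C43 s x k p m u * sigmaBdd (m + α - 1 - u) (p + 1) k) := by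
  rw [S4_eq_sum α s le_rfl]
  have h : ∀ i ∈ Finset.Icc 1 x, (i : ℝ) ^ (α - 1) * coeff x (Sum4 s i)
      = ∑ p ∈ Finset.range (s + 1), ∑ m ∈ Finset.range (s + 1),
      ∑ k ∈ Finset.Icc 1 x, ∑ r ∈ Finset.range (s + 1),
        (C4 s r p m * (x - k).choose r * ((i : ℝ) ^ (m + α)
          * coeff k (X ^ ((p + 1) * i) * ((1 - X ^ i : ℝ⟦X⟧) ^ (s - r + 1))⁻¹))
        - C4 s r p m * ((x + 1 - k).choose (r + 1) * (r + 1)) * ((i : ℝ) ^ (m + α - 1)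
          * coeff k (X ^ ((p + 1) * i) * ((1 - X ^ i : ℝ⟦X⟧) ^ (s - r + 1))⁻¹))) := by
    intro i hi
    have hi0 : i ≠ 0 := by rw [Finset.mem_Icc] at hi; omega
    have hi' : (i : ℝ) ≠ 0 := by exact_mod_cast hi0
    simp only [coeff_Sum4 s x hi0, Finset.mul_sum]
    refine Finset.sum_congr rfl fun p _ => Finset.sum_congr rfl fun m _ =>
      Finset.sum_congr rfl fun k _ => Finset.sum_congr rfl fun r _ => ?_
    rw [show (m : ℝ) + α = (α - 1) + (m + 1 : ℕ) by push_cast; ring,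
      show (α - 1) + (m + 1 : ℕ) - 1 = (α - 1) + (m : ℕ) by push_cast; ring,
      Real.rpow_add_natCast hi', Real.rpow_add_natCast hi']
    ring
  rw [Finset.sum_congr rfl h, Finset.sum_comm]
  refine Finset.sum_congr rfl fun p _ => ?_
  rw [Finset.sum_comm]
  refine Finset.sum_congr rfl fun m _ => ?_
  rw [Finset.sum_comm]
  refine Finset.sum_congr rfl fun k hk => ?_
  rw [Finset.mem_Icc] at hk
  rw [Finset.sum_comm]
  simp only [C42_eq, C43_eq, Finset.sum_mul, ← Finset.sum_sub_distrib]
  rw [Finset.sum_comm (s := Finset.range (s + 1)) (t := Finset.range (s + 1))]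
  refine Finset.sum_congr rfl fun r _ => ?_
  rw [Finset.sum_sub_distrib, ← Finset.mul_sum, ← Finset.mul_sum,
    sum_rpow_mul_coeff _ (Nat.sub_le s r) hk.1 hk.2 (by omega),
    sum_rpow_mul_coeff _ (Nat.sub_le s r) hk.1 hk.2 (by omega), Finset.mul_sum, Finset.mul_sum,
    ← Finset.sum_sub_distrib]
  exact Finset.sum_congr rfl fun u _ => by ring

theorem C43_succ_self (s x k p u : ℕ) : C43 s x k p (s + 1) u = 0 := by
  rw [C43_eq]
  refine Finset.sum_eq_zero fun r _ => ?_
  rw [C4_eq, lambertCoeff_eq_zero_of_lt (by omega)]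
  simp

/-- The `C43` part has one power of the divisor less, so its index `m` is shifted by one: `m = 0` is
left over, and the new top term vanishes by `C43_succ_self`. -/
theorem S4_eq (α : ℝ) (s x : ℕ) :
    S4 α s x
      = (∑ p ∈ Finset.range (s + 1), ∑ m ∈ Finset.range (s + 1), ∑ u ∈ Finset.range (s + 1),
          ∑ k ∈ Finset.Icc 1 x,
            (C42 s x k p m u - C43 s x k p (m + 1) u) * sigmaBdd (m + α - u) (p + 1) k)
        - ∑ p ∈ Finset.range (s + 1), ∑ u ∈ Finset.range (s + 1), ∑ k ∈ Finset.Icc 1 x,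
            C43 s x k p 0 u * sigmaBdd (α - 1 - u) (p + 1) k := by
  rw [S4_eq_sum_sub_sum, ← Finset.sum_sub_distrib]
  refine Finset.sum_congr rfl fun p _ => ?_
  have h1 := Finset.sum_range_succ (fun m : ℕ => ∑ u ∈ Finset.range (s + 1), ∑ k ∈ Finset.Icc 1 x,
    C43 s x k p m u * sigmaBdd (m + α - 1 - u) (p + 1) k) (s + 1)
  have h2 := Finset.sum_range_succ' (fun m : ℕ => ∑ u ∈ Finset.range (s + 1), ∑ k ∈ Finset.Icc 1 x,
    C43 s x k p m u * sigmaBdd (m + α - 1 - u) (p + 1) k) (s + 1)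
  simp only [C43_succ_self, zero_mul, Finset.sum_const_zero, add_zero] at h1
  rw [h1] at h2
  have h3 (m : ℕ) : ((m + 1 : ℕ) : ℝ) + α - 1 = m + α := by push_cast; ring
  simp only [h3, Nat.cast_zero, zero_add] at h2
  simp only [sub_mul, Finset.sum_sub_distrib]
  simp only [Finset.sum_comm (s := Finset.Icc 1 x) (t := Finset.range (s + 1))]
  linear_combination -h2

theorem coeff_X_pow_mul_shifted_binomials {r n : ℕ} (hn : n ≤ r + 1) (N : ℕ) :
    coeff N ((X : ℝ⟦X⟧) ^ n * (C (r.choose n : ℝ) * ((1 - X) ^ (r + 1))⁻¹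
        - C ((r + 1).choose n : ℝ) * ((1 - X) ^ (r + 2))⁻¹))
      = ((N + r - n).choose r : ℝ) * r.choose n
        - (N + 1 + r - n).choose (r + 1) * (r + 1).choose n := by
  rw [coeff_X_pow_mul']
  split_ifs with h
  · rw [map_sub, coeff_C_mul, coeff_C_mul, coeff_inv_one_sub_pow, coeff_inv_one_sub_pow,
      show N - n + r = N + r - n by omega, show N - n + (r + 1) = N + 1 + r - n by omega]
    ring
  · rw [Nat.choose_eq_zero_of_lt (n := N + 1 + r - n) (by omega)]
    -- If `n = r + 1`, the subtraction `N + r - n` may truncate and leave a nonzero first binomial;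
    -- then `r.choose n = 0` removes the term.
    rcases Nat.lt_or_ge r n with hr | hr
    · rw [Nat.choose_eq_zero_of_lt hr]
      simp
    · rw [Nat.choose_eq_zero_of_lt (n := N + r - n) (by omega)]
      simp

/-- Multiplying by `q` removes the `-1` from the exponent, so the coefficient of index `x + 1` is
read and `k` runs to `x + 1`. -/
theorem coeff_Sum8 (s x : ℕ) {i : ℕ} (hi : i ≠ 0) :
    coeff x (Sum8 s i) = ∑ p ∈ Finset.range (s + 1), ∑ w ∈ Finset.range (s + 1),
      ∑ k ∈ Finset.Icc 1 (x + 1), ∑ r ∈ Finset.range (s + 1), ∑ n ∈ Finset.range (r + 2),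
        C8 s r p n w * ((x + 1 + r - n - k).choose r * r.choose n
            - (x + 2 + r - n - k).choose (r + 1) * (r + 1).choose n) * (i : ℝ) ^ w
          * coeff k (X ^ ((p + 2) * i) * ((1 - X ^ i : ℝ⟦X⟧) ^ (s - r + 1))⁻¹) := by
  rw [Sum8, Finset.sum_comm, map_sum]
  refine Finset.sum_congr rfl fun p _ => ?_
  rw [Finset.sum_congr rfl fun r _ => Finset.sum_comm, Finset.sum_comm, map_sum]
  refine Finset.sum_congr rfl fun w _ => ?_
  rw [Finset.sum_comm, map_sum]
  refine Finset.sum_congr rfl fun r _ => ?_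
  rw [Finset.sum_comm, map_sum]
  refine Finset.sum_congr rfl fun n hn => ?_
  have hn' : n ≤ r + 1 := by rw [Finset.mem_range] at hn; omega
  have h : X * (X ^ ((p + 2) * i + n - 1) * ((1 - X ^ i : ℝ⟦X⟧) ^ (s - r + 1))⁻¹
        * (C (r.choose n : ℝ) * ((1 - X) ^ (r + 1))⁻¹
            - C ((r + 1).choose n : ℝ) * ((1 - X) ^ (r + 2))⁻¹)
        * C ((i : ℝ) ^ w) * C (C8 s r p n w))
      = C ((i : ℝ) ^ w * C8 s r p n w)
        * (X ^ ((p + 2) * i) * ((1 - X ^ i : ℝ⟦X⟧) ^ (s - r + 1))⁻¹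
        * (X ^ n * (C (r.choose n : ℝ) * ((1 - X) ^ (r + 1))⁻¹
            - C ((r + 1).choose n : ℝ) * ((1 - X) ^ (r + 2))⁻¹))) := by
    have hpos : 1 ≤ (p + 2) * i := Nat.mul_pos (by omega) (Nat.pos_of_ne_zero hi)
    have hX : (X : ℝ⟦X⟧) * X ^ ((p + 2) * i + n - 1) = X ^ ((p + 2) * i) * X ^ n := by
      rw [← pow_succ', ← pow_add]
      congr 1
      omega
    simp only [← mul_assoc, hX, map_mul]
    ring
  rw [← coeff_succ_X_mul, h, coeff_C_mul,
    coeff_mul_eq_sum_Icc _ _ _ (coeff_zero_X_pow_mul hi (by omega) _), Finset.mul_sum]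
  refine Finset.sum_congr rfl fun k hk => ?_
  rw [Finset.mem_Icc] at hk
  rw [coeff_X_pow_mul_shifted_binomials hn',
    show x + 1 - k + r - n = x + 1 + r - n - k by omega,
    show x + 1 - k + 1 + r - n = x + 2 + r - n - k by omega]
  ring

theorem C82_sub_C83_eq (s x k w p u : ℕ) :
    C82 s x k w p u - C83 s x k w p u
      = ∑ r ∈ Finset.range (s + 1), ∑ n ∈ Finset.range (r + 2),
        C8 s r p n w * ((x + 1 + r - n - k).choose r * r.choose n
            - (x + 2 + r - n - k).choose (r + 1) * (r + 1).choose n)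
          * divisorCoeff (s - r) ((p + 2 : ℕ) - (s - r : ℕ)) k u := by
  rw [C82, C83, ← Finset.sum_sub_distrib]
  refine Finset.sum_congr rfl fun r hr => ?_
  rw [Finset.mem_range] at hr
  rw [← Finset.sum_sub_distrib]
  refine Finset.sum_congr rfl fun n _ => ?_
  rw [divisorCoeff, ← Finset.sum_sub_distrib, Finset.mul_sum]
  refine Finset.sum_congr rfl fun j _ => ?_
  rw [Nat.cast_sub (show r ≤ s by omega), show (((p + 2 : ℕ) : ℝ) - (s - r)) = p + 2 - s + r by
    push_cast; ring]
  ring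

theorem S8_eq (α : ℝ) (s x : ℕ) :
    S8 α s x = ∑ p ∈ Finset.range (s + 1), ∑ u ∈ Finset.range (s + 1), ∑ w ∈ Finset.range (s + 1),
      ∑ k ∈ Finset.Icc 1 (x + 1),
        (C82 s x k w p u - C83 s x k w p u) * sigmaBdd (w + α - 1 - u) (p + 2) k := by
  rw [S8_eq_sum α s (Nat.le_succ x)]
  have h : ∀ i ∈ Finset.Icc 1 (x + 1), (i : ℝ) ^ (α - 1) * coeff x (Sum8 s i)
      = ∑ p ∈ Finset.range (s + 1), ∑ w ∈ Finset.range (s + 1),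
      ∑ k ∈ Finset.Icc 1 (x + 1), ∑ r ∈ Finset.range (s + 1), ∑ n ∈ Finset.range (r + 2),
        C8 s r p n w * ((x + 1 + r - n - k).choose r * r.choose n
            - (x + 2 + r - n - k).choose (r + 1) * (r + 1).choose n) * ((i : ℝ) ^ (w + α - 1)
          * coeff k (X ^ ((p + 2) * i) * ((1 - X ^ i : ℝ⟦X⟧) ^ (s - r + 1))⁻¹)) := by
    intro i hi
    have hi0 : i ≠ 0 := by rw [Finset.mem_Icc] at hi; omega
    have hi' : (i : ℝ) ≠ 0 := by exact_mod_cast hi0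
    simp only [coeff_Sum8 s x hi0, Finset.mul_sum]
    refine Finset.sum_congr rfl fun p _ => Finset.sum_congr rfl fun w _ =>
      Finset.sum_congr rfl fun k _ => Finset.sum_congr rfl fun r _ =>
      Finset.sum_congr rfl fun n _ => ?_
    rw [show (w : ℝ) + α - 1 = (α - 1) + (w : ℕ) by ring, Real.rpow_add_natCast hi']
    ring
  rw [Finset.sum_congr rfl h, Finset.sum_comm]
  refine Finset.sum_congr rfl fun p _ => ?_
  rw [Finset.sum_comm, Finset.sum_comm (s := Finset.range (s + 1)) (t := Finset.range (s + 1))]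
  refine Finset.sum_congr rfl fun w _ => ?_
  rw [Finset.sum_comm, Finset.sum_comm (s := Finset.range (s + 1)) (t := Finset.Icc 1 (x + 1))]
  refine Finset.sum_congr rfl fun k hk => ?_
  rw [Finset.mem_Icc] at hk
  rw [Finset.sum_comm]
  simp only [C82_sub_C83_eq, Finset.sum_mul]
  rw [Finset.sum_comm (s := Finset.range (s + 1)) (t := Finset.range (s + 1))]
  refine Finset.sum_congr rfl fun r _ => ?_
  rw [Finset.sum_comm, Finset.sum_comm (s := Finset.range (s + 1)) (t := Finset.range (r + 2))]
  refine Finset.sum_congr rfl fun n _ => ?_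
  rw [← Finset.mul_sum, sum_rpow_mul_coeff _ (Nat.sub_le s r) hk.1 hk.2 (by omega), Finset.mul_sum]
  exact Finset.sum_congr rfl fun u _ => by ring

end DivisorSums

end

open DivisorSums in
theorem mainTheorem4 (α : ℝ) (hα : 0 ≤ α) :
    -- the exact formula
    (∀ s x : ℕ, 2 ≤ s → 1 ≤ x →
      (x.choose s : ℝ) * sigma α x
        = 1 / (s.factorial : ℝ)
          * (S01 α s x + S48 α s x - S48 α s (x - 1) - s * S48 α (s - 1) (x - 1)))
    -- its ingredients are finite sums over (bounded-divisor) divisor sums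
    ∧ (∀ s x : ℕ, 1 ≤ s →
      S01 α s x
          = ∑ r ∈ Finset.range (s + 1), ∑ k ∈ Finset.Icc 1 x,
              (s.choose r : ℝ) * (x - k).choose (s - r) * (s - r).factorial
                * (k : ℝ) ^ (α - 1) * k.descFactorial r
      ∧ S4 α s x
          = (∑ p ∈ Finset.range (s + 1), ∑ m ∈ Finset.range (s + 1), ∑ u ∈ Finset.range (s + 1),
              ∑ k ∈ Finset.Icc 1 x,
                (C42 s x k p m u - C43 s x k p (m + 1) u) * sigmaBdd (m + α - u) (p + 1) k)
            - ∑ p ∈ Finset.range (s + 1), ∑ u ∈ Finset.range (s + 1), ∑ k ∈ Finset.Icc 1 x,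
                C43 s x k p 0 u * sigmaBdd (α - 1 - u) (p + 1) k
      ∧ S8 α s x
          = ∑ p ∈ Finset.range (s + 1), ∑ u ∈ Finset.range (s + 1), ∑ w ∈ Finset.range (s + 1),
              ∑ k ∈ Finset.Icc 1 (x + 1),
                (C82 s x k w p u - C83 s x k w p u) * sigmaBdd (w + α - 1 - u) (p + 2) k) := by
  exact ⟨fun s x hs hx => choose_mul_sigma_eq α (by omega) hx,
    fun s x _ => ⟨S01_eq α s x, S4_eq α s x, S8_eq α s x⟩⟩
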